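/- **Theorem.** Let $m\ge 0$ be a fixed dimension and let $\mathbb P$ be the open cone of positive definite complex $m\times m$ matrices, with the topology inherited from the space of matrices. Write $A\le B$ when $B-A$ is positive semidefinite (the Loewner order), and let $$\delta(A,B)=\|\log(A^{-1/2}BA^{-1/2})\|_2,\qquad \|H\|_2=(\operatorname{Tr}H^2)^{1/2}\ (H\text{ hermitian}).$$ Let $n\ge 3$. A *weight* is a tuple $\mathbf w=(w_1,\dots,w_n)$ of reals with $0<w_i\le 1$ and $\sum_i w_i=1$. For $\mathbb A=(A_1,\dots,A_n)\in\mathbb P^n$ the functions $$X\mapsto\sum_{i=1}^n\delta(X,A_i)^2\qquad\text{and}\qquad X\mapsto\sum_{i=1}^n w_i\,\delta(X,A_i)^2$$ on $\mathbb P$ each have a unique minimizer. The first is denoted $\Lambda(\mathbb A)$ (the least squares mean), the second $\Lambda(\mathbf w;\mathbb A)$ (the weighted least squares mean). 1. **Monotonicity.** If $A_i\le B_i$ for $1\le i\le n$, then $\Lambda(\mathbb A)\le\Lambda(\mathbb B)$, and $\Lambda(\mathbf w;\mathbb A)\le\Lambda(\mathbf w;\mathbb B)$ for every weight $\mathbf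 w$. 2. **The other nine axioms.** For all weights $\mathbf w$, all $\mathbb A,\mathbb B\in\mathbb P^n$, all reals $a_1,\dots,a_n>0$, all permutations $\sigma$ of $\{1,\dots,n\}$, all invertible complex $m\times m$ matrices $M$ and all $\lambda\in[0,1]$: - (consistency with scalars) $\Lambda(\mathbf w;\mathbb A)=A_1^{w_1}\cdots A_n^{w_n}$ if the $A_i$ commute pairwise; - (joint homogeneity) $\Lambda(\mathbf w;a_1A_1,\dots,a_nA_n)=a_1^{w_1}\cdots a_n^{w_n}\,\Lambda(\mathbf w;\mathbb A)$; - (permutation invariance) $\Lambda(w_{\sigma(1)},\dots,w_{\sigma(n)};A_{\sigma(1)},\dots,A_{\sigma(n)})=\Lambda(\mathbf w;\mathbb A)$; - (continuity) $(\mathbf w,\mathbb A)\mapsto\Lambda(\mathbf w;\mathbb A)$ is continuous; - (congruence invariance) $\Lambda(\mathbf w;MA_1M^*,\dots,MA_nM^*)=M\,\Lambda(\mathbf w;\mathbb A)\,M^*$; - (joint concavity) $\Lambda(\mathbf w;\lambda\mathbb A+(1-\lambda)\mathbb B)\ge\lambda\Lambda(\mathbf w;\mathbb A)+(1-\lambda)\Lambda(\mathbf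 w;\mathbb B)$; - (self-duality) $\Lambda(\mathbf w;A_1^{-1},\dots,A_n^{-1})^{-1}=\Lambda(\mathbf w;\mathbb A)$; - (determinantal identity) $\det\Lambda(\mathbf w;\mathbb A)=\prod_{i=1}^n(\det A_i)^{w_i}$; - (arithmetic-geometric-harmonic mean inequalities) $\bigl(\sum_{i=1}^n w_iA_i^{-1}\bigr)^{-1}\le\Lambda(\mathbf w;\mathbb A)\le\sum_{i=1}^n w_iA_i$. The unweighted mean satisfies the corresponding unweighted properties: $\Lambda(\mathbb A)=(A_1\cdots A_n)^{1/n}$ if the $A_i$ commute pairwise; $\Lambda(a_1A_1,\dots,a_nA_n)=(a_1\cdots a_n)^{1/n}\Lambda(\mathbb A)$; $\Lambda(A_{\sigma(1)},\dots,A_{\sigma(n)})=\Lambda(\mathbb A)$; $\Lambda$ is continuous on $\mathbb P^n$; $\Lambda(MA_1M^*,\dots,MA_nM^*)=M\Lambda(\mathbb A)M^*$; $\Lambda(\lambda\mathbb A+(1-\lambda)\mathbb B)\ge\lambda\Lambda(\mathbb A)+(1-\lambda)\Lambda(\mathbb B)$; $\Lambda(A_1^{-1},\dots,A_n^{-1})^{-1}=\Lambda(\mathbb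 A)$; $\det\Lambda(\mathbb A)=\prod_i(\det A_i)^{1/n}$; and $n\bigl(\sum_iA_i^{-1}\bigr)^{-1}\le\Lambda(\mathbb A)\le\frac1n\sum_iA_i$. -/

import Mathlib

open scoped ComplexOrder MatrixOrder Matrix

/-- The open cone `ℙ` of positive definite complex `m × m` matrices, with the topology
inherited from the space of matrices. -/
abbrev PDCone (m : ℕ) : Type := {A : Matrix (Fin m) (Fin m) ℂ // A.PosDef}

/-- Weights of length `n`: `n`-tuples of reals `w i` with `0 < w i ≤ 1` and sum `1`. -/
abbrev Weight (n : ℕ) : Type :=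
  {w : Fin n → ℝ // (∀ i, 0 < w i ∧ w i ≤ 1) ∧ ∑ i, w i = 1}

/-- The weight `(w (σ 1), …, w (σ n))`. -/
def Weight.perm {n : ℕ} (w : Weight n) (σ : Equiv.Perm (Fin n)) : Weight n :=
  ⟨fun i => w.1 (σ i), fun i => w.2.1 (σ i), by rw [Equiv.sum_comp σ w.1]; exact w.2.2⟩

namespace PDCone

variable {m : ℕ}

/-- The positive definite identity matrix. -/
noncomputable def one : PDCone m := ⟨1, Matrix.PosDef.one⟩

instance instNonempty : Nonempty (PDCone m) := ⟨one⟩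

/-- The positive multiple `a A`. -/
noncomputable def scale (a : {a : ℝ // 0 < a}) (A : PDCone m) : PDCone m :=
  ⟨a.1 • A.1, A.2.smul a.2⟩

/-- The inverse `A⁻¹`. -/
noncomputable def inv (A : PDCone m) : PDCone m := ⟨A.1⁻¹, A.2.inv⟩

/-- The congruence transform `M A M*` by an invertible matrix `M`. -/
noncomputable def congruence (M : GL (Fin m) ℂ) (A : PDCone m) : PDCone m :=
  ⟨M.1 * A.1 * M.1ᴴ, (Matrix.IsUnit.posDef_star_right_conjugate_iff M.isUnit).2 A.2⟩

/-- The convex combination `t A + (1 - t) B`, for `0 ≤ t ≤ 1`. -/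
noncomputable def mix (t : Set.Icc (0 : ℝ) 1) (A B : PDCone m) : PDCone m :=
  ⟨t.1 • A.1 + (1 - t.1) • B.1, by
    rcases t with ⟨t, h0, h1⟩
    rcases h0.eq_or_lt with rfl | h0
    · simpa using B.2
    · exact (A.2.smul h0).add_posSemidef (B.2.posSemidef.smul (sub_nonneg.2 h1))⟩

end PDCone

section Metric

variable {m : ℕ}

/-- Real powers of a (positive definite) matrix, by functional calculus: if `A = ∑ λᵢ Eᵢ` is
the spectral decomposition, this is `∑ λᵢ ^ t Eᵢ`. -/
noncomputable def matPow (A : Matrix (Fin m) (Fin m) ℂ) (t : ℝ) : Matrix (Fin m) (Fin m) ℂ :=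
  cfc (fun x : ℝ => x ^ t) A

/-- The logarithm of a (positive definite) matrix, by functional calculus: if `A = ∑ λᵢ Eᵢ` is
the spectral decomposition, this is `∑ log λᵢ Eᵢ`. -/
noncomputable def matLog (A : Matrix (Fin m) (Fin m) ℂ) : Matrix (Fin m) (Fin m) ℂ :=
  cfc Real.log A

/-- The Frobenius norm `(Tr (H H)) ^ (1/2)` of a hermitian matrix `H`. -/
noncomputable def frobNorm (H : Matrix (Fin m) (Fin m) ℂ) : ℝ :=
  Real.sqrt (H * H).trace.re

/-- The Riemannian distance `δ(A, B) = ‖log (A^(-1/2) B A^(-1/2))‖₂` on `ℙ`. -/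
noncomputable def riemDist (A B : PDCone m) : ℝ :=
  frobNorm (matLog (matPow A.1 (-1 / 2) * B.1 * matPow A.1 (-1 / 2)))

end Metric

section LeastSquares

variable {n m : ℕ}

/-- `X` minimizes `Y ↦ ∑ δ(Y, A i)²` over `ℙ`. -/
def IsLeastSquaresPoint (A : Fin n → PDCone m) (X : PDCone m) : Prop :=
  ∀ Y : PDCone m, ∑ i, riemDist X (A i) ^ 2 ≤ ∑ i, riemDist Y (A i) ^ 2

/-- `X` minimizes `Y ↦ ∑ w i δ(Y, A i)²` over `ℙ`. -/
def IsWeightedLeastSquaresPoint (w : Weight n) (A : Fin n → PDCone m) (X : PDCone m) : Prop :=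
  ∀ Y : PDCone m, ∑ i, w.1 i * riemDist X (A i) ^ 2 ≤ ∑ i, w.1 i * riemDist Y (A i) ^ 2

/-- The least squares mean `Λ(A 1, …, A n)`: the minimizer of `∑ δ(Y, A i)²`. -/
noncomputable def leastSquaresMean (A : Fin n → PDCone m) : PDCone m :=
  Classical.epsilon (IsLeastSquaresPoint A)

/-- The weighted least squares mean `Λ(w; A 1, …, A n)`: the minimizer of
`∑ w i δ(Y, A i)²`. -/
noncomputable def weightedLeastSquaresMean (w : Weight n) (A : Fin n → PDCone m) : PDCone m :=
  Classical.epsilon (IsWeightedLeastSquaresPoint w A)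

end LeastSquares

/-- The axioms of Ando, Li and Mathias, except monotonicity,
for an `n`-variable mean `γ` on `ℙ`.
The order `≤` on matrices is the Loewner order. The two bounds by the harmonic and the arithmetic
mean together form the last axiom. -/
structure ALMAxiomsExceptMonotone {n m : ℕ} (γ : (Fin n → PDCone m) → PDCone m) : Prop where
  consistency_with_scalars : ∀ A : Fin n → PDCone m, (∀ i j, Commute (A i).1 (A j).1) →
    (γ A).1 = matPow (List.ofFn fun i => (A i).1).prod (1 / (n : ℝ))
  joint_homogeneity : ∀ (a : Fin n → {a : ℝ // 0 < a}) (A : Fin n → PDCone m),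
    (γ fun i => (A i).scale (a i)).1 = ((∏ i, (a i).1) ^ (1 / (n : ℝ))) • (γ A).1
  permutation_invariance : ∀ (σ : Equiv.Perm (Fin n)) (A : Fin n → PDCone m),
    γ (fun i => A (σ i)) = γ A
  continuity : Continuous γ
  congruence_invariance : ∀ (M : GL (Fin m) ℂ) (A : Fin n → PDCone m),
    γ (fun i => (A i).congruence M) = (γ A).congruence M
  joint_concavity : ∀ (t : Set.Icc (0 : ℝ) 1) (A B : Fin n → PDCone m),
    t.1 • (γ A).1 + (1 - t.1) • (γ B).1 ≤ (γ fun i => PDCone.mix t (A i) (B i)).1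
  self_duality : ∀ A : Fin n → PDCone m, (γ fun i => (A i).inv).inv = γ A
  determinantal_identity : ∀ A : Fin n → PDCone m,
    (γ A).1.det = ((∏ i, (A i).1.det.re ^ (1 / (n : ℝ)) : ℝ) : ℂ)
  harmonic_le : ∀ A : Fin n → PDCone m, (n : ℝ) • (∑ i, (A i).1⁻¹)⁻¹ ≤ (γ A).1
  le_arithmetic : ∀ A : Fin n → PDCone m, (γ A).1 ≤ (1 / (n : ℝ)) • ∑ i, (A i).1

/-- The weighted versions of the axioms of Ando, Li and Mathias, except monotonicity, for an `n`-variable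
weighted mean `γ` on `ℙ`. Continuity is joint in the weight and the matrices. -/
structure WeightedALMAxiomsExceptMonotone {n m : ℕ}
    (γ : Weight n → (Fin n → PDCone m) → PDCone m) : Prop where
  consistency_with_scalars : ∀ (w : Weight n) (A : Fin n → PDCone m),
    (∀ i j, Commute (A i).1 (A j).1) →
    (γ w A).1 = (List.ofFn fun i => matPow (A i).1 (w.1 i)).prod
  joint_homogeneity : ∀ (w : Weight n) (a : Fin n → {a : ℝ // 0 < a}) (A : Fin n → PDCone m),
    (γ w fun i => (A i).scale (a i)).1 = (∏ i, (a i).1 ^ w.1 i) • (γ w A).1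
  permutation_invariance : ∀ (w : Weight n) (σ : Equiv.Perm (Fin n)) (A : Fin n → PDCone m),
    γ (w.perm σ) (fun i => A (σ i)) = γ w A
  continuity : Continuous fun p : Weight n × (Fin n → PDCone m) => γ p.1 p.2
  congruence_invariance : ∀ (w : Weight n) (M : GL (Fin m) ℂ) (A : Fin n → PDCone m),
    γ w (fun i => (A i).congruence M) = (γ w A).congruence M
  joint_concavity : ∀ (w : Weight n) (t : Set.Icc (0 : ℝ) 1) (A B : Fin n → PDCone m),
    t.1 • (γ w A).1 + (1 - t.1) • (γ w B).1 ≤ (γ w fun i => PDCone.mix t (A i) (B i)).1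
  self_duality : ∀ (w : Weight n) (A : Fin n → PDCone m), (γ w fun i => (A i).inv).inv = γ w A
  determinantal_identity : ∀ (w : Weight n) (A : Fin n → PDCone m),
    (γ w A).1.det = ((∏ i, (A i).1.det.re ^ w.1 i : ℝ) : ℂ)
  harmonic_le : ∀ (w : Weight n) (A : Fin n → PDCone m),
    (∑ i, w.1 i • (A i).1⁻¹)⁻¹ ≤ (γ w A).1
  le_arithmetic : ∀ (w : Weight n) (A : Fin n → PDCone m), (γ w A).1 ≤ ∑ i, w.1 i • (A i).1

/-! ### Powers and logarithms by functional calculus -/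

section FunctionalCalculus

open scoped Matrix.Norms.L2Operator

variable {m : ℕ} {A B M : Matrix (Fin m) (Fin m) ℂ}

/-! The mean is identified with the unique solution of the Karcher equation `∑ wᵢ log(X^(-1/2) Aᵢ
X^(-1/2)) = 0`. The exponential metric increasing property says that `log` does not increase
distances from `δ` to the Frobenius norm. Expanding a square at a Karcher point, where the cross
term vanishes, turns it into a variance inequality (`IsKarcherPoint.variance_inequality`). So any
Karcher point is the only minimizer.

Existence and order both come from the maps `X ↦ ∑ wᵢ (X #ₜ Aᵢ)`, `t = 2^(-k)`. The geometric mean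
`#ₜ` is jointly monotone and concave: for `t = 1/2` by a Schur complement argument, for smaller
dyadic `t` by iteration. Homogeneity of degree `1 - t < 1` gives a comparison principle, and
monotone iteration gives a fixed point `X_t`. Its equation is the Karcher equation with `log C`
replaced by `(C^t - 1)/t`, which decreases to `log C` as `t → 0`. A cluster point of the `X_t` is
therefore a Karcher point, and it lies above every `Z` satisfying `Z ≤ ∑ wᵢ (Z #ₜ Aᵢ)` for all these
`t` (`exists_isKarcherPoint`).

Since `log C ≤ (C^t - 1)/t`, the mean is itself such a subsolution, hence the greatest one.
Monotonicity and joint concavity follow because `Λ(A)`, or a mixture of two means, is a subsolution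
for the new data. The remaining axioms are read off the Karcher equation, the invariance of `δ`, or
the case `t = 1`; continuity is compactness plus uniqueness. -/

theorem continuousOn_spectrum (A : Matrix (Fin m) (Fin m) ℂ) (f : ℝ → ℝ) :
    ContinuousOn f (spectrum ℝ A) :=
  Matrix.finite_real_spectrum.continuousOn f

theorem Matrix.PosDef.spectrum_pos (hA : A.PosDef) {x : ℝ} (hx : x ∈ spectrum ℝ A) : 0 < x :=
  hA.isStrictlyPositive.spectrum_pos hx

theorem posDef_cfc (hA : A.IsHermitian) {f : ℝ → ℝ} (hf : ∀ x ∈ spectrum ℝ A, 0 < f x) :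
    (cfc f A).PosDef :=
  Matrix.isStrictlyPositive_iff_posDef.1
    ((cfc_isStrictlyPositive_iff f A (continuousOn_spectrum A f) hA).2 hf)

theorem matPow_posDef (hA : A.PosDef) (t : ℝ) : (matPow A t).PosDef :=
  posDef_cfc hA.1 fun _ hx => Real.rpow_pos_of_pos (hA.spectrum_pos hx) t

theorem matPow_isHermitian (A : Matrix (Fin m) (Fin m) ℂ) (t : ℝ) : (matPow A t).IsHermitian :=
  cfc_predicate _ A

theorem matLog_isHermitian (A : Matrix (Fin m) (Fin m) ℂ) : (matLog A).IsHermitian :=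
  cfc_predicate _ A

theorem matPow_mul_matPow (hA : A.PosDef) (s t : ℝ) :
    matPow A s * matPow A t = matPow A (s + t) := by
  unfold matPow
  rw [← cfc_mul _ _ A (continuousOn_spectrum _ _) (continuousOn_spectrum _ _)]
  exact cfc_congr fun x hx => (Real.rpow_add (hA.spectrum_pos hx) s t).symm

theorem matPow_zero (hA : A.PosDef) : matPow A 0 = 1 := by
  have hA' : IsSelfAdjoint A := hA.1
  simp [matPow, cfc_const_one ℝ A]

theorem matPow_one (hA : A.PosDef) : matPow A 1 = A := by
  have hA' : IsSelfAdjoint A := hA.1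
  simp [matPow, cfc_id' ℝ A]

theorem matPow_matPow (hA : A.PosDef) (s t : ℝ) : matPow (matPow A s) t = matPow A (s * t) := by
  have hA' : IsSelfAdjoint A := hA.1
  unfold matPow
  rw [← cfc_comp' _ _ A ((Matrix.finite_real_spectrum.image _).continuousOn _)
    (continuousOn_spectrum _ _)]
  exact cfc_congr fun x hx => (Real.rpow_mul (hA.spectrum_pos hx).le s t).symm

theorem matPow_neg_mul (hA : A.PosDef) (t : ℝ) : matPow A (-t) * matPow A t = 1 := by
  rw [matPow_mul_matPow hA, neg_add_cancel, matPow_zero hA]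

theorem matPow_mul_neg (hA : A.PosDef) (t : ℝ) : matPow A t * matPow A (-t) = 1 := by
  rw [matPow_mul_matPow hA, add_neg_cancel, matPow_zero hA]

theorem matPow_inv (hA : A.PosDef) (t : ℝ) : (matPow A t)⁻¹ = matPow A (-t) :=
  Matrix.inv_eq_left_inv (matPow_neg_mul hA t)

theorem matPow_neg_one (hA : A.PosDef) : matPow A (-1) = A⁻¹ := by
  rw [← matPow_inv hA, matPow_one hA]

theorem inv_matPow (hA : A.PosDef) (t : ℝ) : matPow A⁻¹ t = matPow A (-t) := by
  rw [← matPow_neg_one hA, matPow_matPow hA, neg_one_mul]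

theorem matLog_matPow (hA : A.PosDef) (t : ℝ) : matLog (matPow A t) = t • matLog A := by
  have hA' : IsSelfAdjoint A := hA.1
  unfold matLog matPow
  rw [← cfc_comp' _ _ A ((Matrix.finite_real_spectrum.image _).continuousOn _)
    (continuousOn_spectrum _ _), ← cfc_smul _ _ _ (continuousOn_spectrum _ _)]
  exact cfc_congr fun x hx => by simp [Real.log_rpow (hA.spectrum_pos hx)]

theorem matLog_inv (hA : A.PosDef) : matLog A⁻¹ = -matLog A := by
  rw [← matPow_neg_one hA, matLog_matPow hA, neg_one_smul]

theorem matLog_smul (hA : A.PosDef) {r : ℝ} (hr : 0 < r) :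
    matLog (r • A) = Real.log r • 1 + matLog A := by
  have := CFC.log_smul' A hr hA.isStrictlyPositive
  rwa [Algebra.algebraMap_eq_smul_one] at this

theorem matPow_smul (hA : A.PosDef) {r : ℝ} (hr : 0 < r) (t : ℝ) :
    matPow (r • A) t = r ^ t • matPow A t := by
  have hA' : IsSelfAdjoint A := hA.1
  unfold matPow
  rw [← cfc_smul _ _ _ (continuousOn_spectrum _ _)]
  conv_lhs => rw [← cfc_smul_id (R := ℝ) r A]
  rw [← cfc_comp' _ _ A ((Matrix.finite_real_spectrum.image _).continuousOn _)
    (continuousOn_spectrum _ _)]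
  exact cfc_congr fun x hx => by simp [Real.mul_rpow hr.le (hA.spectrum_pos hx).le]

theorem exp_matLog (hA : A.PosDef) : NormedSpace.exp (matLog A) = A :=
  CFC.exp_log A hA.isStrictlyPositive

theorem matLog_exp (hA : A.IsHermitian) : matLog (NormedSpace.exp A) = A :=
  CFC.log_exp A hA

theorem cfc_unitary_conj {U : Matrix (Fin m) (Fin m) ℂ} (hU : U ∈ unitary (Matrix (Fin m) (Fin m) ℂ))
    (hA : A.IsHermitian) (f : ℝ → ℝ) : cfc f (U * A * star U) = U * cfc f A * star U := by
  have h := StarAlgHomClass.map_cfc (Unitary.conjStarAlgAut ℝ _ (⟨U, hU⟩ : unitary _)) f A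
    (continuousOn_spectrum A f) (by
      change Continuous fun x => U * x * star U
      fun_prop) hA (by
      exact IsSelfAdjoint.map (show IsSelfAdjoint A from hA) _)
  simpa only [Unitary.conjStarAlgAut_apply] using h.symm

theorem matPow_mono {t : ℝ} (h0 : 0 ≤ t) (h1 : t ≤ 1) (hA' : 0 ≤ A) (hAB : A ≤ B) :
    matPow A t ≤ matPow B t := by
  have hB' : 0 ≤ B := hA'.trans hAB
  have := CFC.rpow_le_rpow (p := t) ⟨h0, h1⟩ hAB
  rwa [CFC.rpow_eq_cfc_real hA', CFC.rpow_eq_cfc_real hB'] at this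

theorem Matrix.PosDef.of_le (hA : A.PosDef) (hAB : A ≤ B) : B.PosDef :=
  Matrix.isStrictlyPositive_iff_posDef.1 (hA.isStrictlyPositive.of_le hAB)

theorem continuousOn_cfc_posDef {f : ℝ → ℝ} (hf : ContinuousOn f (Set.Ioi 0)) :
    ContinuousOn (fun A : Matrix (Fin m) (Fin m) ℂ => cfc f A) {A | A.PosDef} := by
  refine continuousOn_id.cfc_of_mem_nhdsSet f (s := Set.Ioi 0) ?_ (fun A hA => hA.1) hf
  refine isOpen_Ioi.mem_nhdsSet.2 ?_
  simp only [Set.iUnion_subset_iff]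
  exact fun A hA x hx => Matrix.PosDef.spectrum_pos hA hx

theorem continuousOn_matPow (t : ℝ) :
    ContinuousOn (fun A : Matrix (Fin m) (Fin m) ℂ => matPow A t) {A | A.PosDef} :=
  continuousOn_cfc_posDef fun x hx =>
    (Real.continuousAt_rpow_const x t (Or.inl (ne_of_gt hx))).continuousWithinAt

theorem continuousOn_matLog :
    ContinuousOn (fun A : Matrix (Fin m) (Fin m) ℂ => matLog A) {A | A.PosDef} :=
  continuousOn_cfc_posDef (Real.continuousOn_log.mono fun _ hx => ne_of_gt hx)

theorem conj_le_conj (h : A ≤ B) (M : Matrix (Fin m) (Fin m) ℂ) : M * A * Mᴴ ≤ M * B * Mᴴ :=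
  star_right_conjugate_le_conjugate h M

theorem Matrix.IsHermitian.conj_le_conj (hM : M.IsHermitian) (h : A ≤ B) :
    M * A * M ≤ M * B * M := by
  simpa only [hM.eq] using _root_.conj_le_conj h M

theorem Matrix.PosDef.conj (hA : A.PosDef) (hM : M.PosDef) : (M * A * M).PosDef := by
  have := (Matrix.IsUnit.posDef_star_right_conjugate_iff hM.isUnit).2 hA
  rwa [Matrix.star_eq_conjTranspose, hM.1.eq] at this

theorem Matrix.PosDef.inv_mul_self (hA : A.PosDef) : A⁻¹ * A = 1 :=
  Matrix.nonsing_inv_mul A ((Matrix.isUnit_iff_isUnit_det A).1 hA.isUnit)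

end FunctionalCalculus

/-! ### Changing the base point by congruence -/

section Relative

variable {m : ℕ} {A B M X : Matrix (Fin m) (Fin m) ℂ}

theorem matPow_half_mul_half (hX : X.PosDef) : matPow X (1 / 2) * matPow X (1 / 2) = X := by
  rw [matPow_mul_matPow hX, add_halves, matPow_one hX]

theorem matPow_neg_half_mul_half (hX : X.PosDef) : matPow X (-1 / 2) * matPow X (1 / 2) = 1 := by
  rw [neg_div, matPow_neg_mul hX]

theorem matPow_half_mul_neg_half (hX : X.PosDef) : matPow X (1 / 2) * matPow X (-1 / 2) = 1 := by
  rw [neg_div, matPow_mul_neg hX]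

theorem matPow_neg_half_mul_neg_half (hX : X.PosDef) :
    matPow X (-1 / 2) * matPow X (-1 / 2) = X⁻¹ := by
  rw [matPow_mul_matPow hX, ← matPow_neg_one hX]
  norm_num

/-- The matrix `A` seen from `X`, namely `X^(-1/2) A X^(-1/2)`. -/
noncomputable def relMat (X A : Matrix (Fin m) (Fin m) ℂ) : Matrix (Fin m) (Fin m) ℂ :=
  matPow X (-1 / 2) * A * matPow X (-1 / 2)

theorem relMat_posDef (hX : X.PosDef) (hA : A.PosDef) : (relMat X A).PosDef :=
  hA.conj (matPow_posDef hX _)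

theorem conj_relMat (hX : X.PosDef) (A : Matrix (Fin m) (Fin m) ℂ) :
    matPow X (1 / 2) * relMat X A * matPow X (1 / 2) = A := by
  simp only [relMat, mul_assoc, matPow_neg_half_mul_half hX, mul_one]
  rw [← mul_assoc, matPow_half_mul_neg_half hX, one_mul]

theorem relMat_conj (hX : X.PosDef) (A : Matrix (Fin m) (Fin m) ℂ) :
    relMat X (matPow X (1 / 2) * A * matPow X (1 / 2)) = A := by
  simp only [relMat, mul_assoc, matPow_half_mul_neg_half hX, mul_one]
  rw [← mul_assoc, matPow_neg_half_mul_half hX, one_mul]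

theorem relMat_self (hX : X.PosDef) : relMat X X = 1 := by
  have := relMat_conj hX 1
  rwa [mul_one, matPow_half_mul_half hX] at this

theorem relMat_mono (X : Matrix (Fin m) (Fin m) ℂ) (h : A ≤ B) : relMat X A ≤ relMat X B :=
  (matPow_isHermitian X _).conj_le_conj h

theorem relMat_inv (hX : X.PosDef) (A : Matrix (Fin m) (Fin m) ℂ) :
    relMat X⁻¹ A⁻¹ = (relMat X A)⁻¹ := by
  simp only [relMat, Matrix.mul_inv_rev, matPow_inv hX, inv_matPow hX, mul_assoc]

theorem relMat_smul (hX : X.PosDef) (A : Matrix (Fin m) (Fin m) ℂ) {r : ℝ} (hr : 0 < r) (a : ℝ) :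
    relMat (r • X) (a • A) = (r⁻¹ * a) • relMat X A := by
  simp only [relMat, matPow_smul hX hr, smul_mul_assoc, mul_smul_comm, smul_smul]
  congr 1
  rw [mul_comm a, ← mul_assoc, ← Real.rpow_add hr, ← Real.rpow_neg_one]
  norm_num

/-- Simultaneous congruence acts on `relMat` by a unitary conjugation. -/
theorem exists_unitary_relMat_congr (hX : X.PosDef) (hM : IsUnit M)
    (A : Matrix (Fin m) (Fin m) ℂ) :
    ∃ V ∈ unitary (Matrix (Fin m) (Fin m) ℂ),
      relMat (M * X * Mᴴ) (M * A * Mᴴ) = V * relMat X A * star V := by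
  have hY : (M * X * Mᴴ).PosDef := (Matrix.IsUnit.posDef_star_right_conjugate_iff hM).2 hX
  have h1 : matPow X (1 / 2) * (matPow X (1 / 2) * Mᴴ) = X * Mᴴ := by
    rw [← mul_assoc, matPow_half_mul_half hX]
  have h2 := conj_relMat hX A
  refine ⟨matPow (M * X * Mᴴ) (-1 / 2) * M * matPow X (1 / 2), ?_, ?_⟩
  · have : matPow (M * X * Mᴴ) (-1 / 2) * M * matPow X (1 / 2) *
        star (matPow (M * X * Mᴴ) (-1 / 2) * M * matPow X (1 / 2)) = 1 := by
      rw [← relMat_self hY]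
      simp only [relMat, Matrix.star_eq_conjTranspose, Matrix.conjTranspose_mul,
        (matPow_isHermitian _ _).eq, mul_assoc]
      rw [← mul_assoc (matPow X _) (matPow X _), matPow_half_mul_half hX]
    exact ⟨mul_eq_one_comm.1 this, this⟩
  · conv_lhs => rw [← h2]
    simp only [relMat, Matrix.star_eq_conjTranspose, Matrix.conjTranspose_mul,
        (matPow_isHermitian _ _).eq, mul_assoc]

end Relative

/-! ### Trace formulas and the infinitesimal metric estimate -/

section Frobenius

variable {m : ℕ} {A B C : Matrix (Fin m) (Fin m) ℂ}

theorem Matrix.IsHermitian.trace_mul_self_re (hA : A.IsHermitian) :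
    (A * A).trace.re = ∑ i, ∑ j, ‖A i j‖ ^ 2 := by
  simp only [Matrix.trace, Matrix.diag, Matrix.mul_apply, Complex.re_sum]
  refine Finset.sum_congr rfl fun i _ => Finset.sum_congr rfl fun j _ => ?_
  rw [← hA.apply j i, Complex.star_def, Complex.mul_conj, Complex.ofReal_re, Complex.sq_norm]

theorem Matrix.IsHermitian.trace_mul_self_nonneg (hA : A.IsHermitian) :
    0 ≤ (A * A).trace.re := by
  rw [hA.trace_mul_self_re]
  positivity

theorem Matrix.IsHermitian.eq_zero_of_trace_mul_self (hA : A.IsHermitian)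
    (h : (A * A).trace.re ≤ 0) : A = 0 := by
  rw [hA.trace_mul_self_re] at h
  have h0 := le_antisymm h (by positivity)
  rw [Finset.sum_eq_zero_iff_of_nonneg fun i _ => by positivity] at h0
  ext i j
  have := h0 i (Finset.mem_univ i)
  rw [Finset.sum_eq_zero_iff_of_nonneg fun i _ => by positivity] at this
  simpa using this j (Finset.mem_univ j)

theorem frobNorm_sq (hA : A.IsHermitian) : frobNorm A ^ 2 = (A * A).trace.re :=
  Real.sq_sqrt hA.trace_mul_self_nonneg

/-- Cauchy–Schwarz in each entry. It is the discrete form of "length squared is at most time times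
energy" and is applied to a subdivided geodesic. -/
theorem trace_mul_self_sum_le {N : ℕ} (D : ℕ → Matrix (Fin m) (Fin m) ℂ)
    (hD : ∀ k, (D k).IsHermitian) :
    ((∑ k ∈ Finset.range N, D k) * ∑ k ∈ Finset.range N, D k).trace.re
      ≤ N * ∑ k ∈ Finset.range N, (D k * D k).trace.re := by
  have hs : (∑ k ∈ Finset.range N, D k).IsHermitian :=
    isSelfAdjoint_sum _ fun k _ => (hD k : IsSelfAdjoint (D k))
  simp only [hs.trace_mul_self_re, (hD _).trace_mul_self_re]
  rw [Finset.sum_comm (s := Finset.range N), Finset.mul_sum]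
  refine Finset.sum_le_sum fun i _ => ?_
  rw [Finset.sum_comm (s := Finset.range N), Finset.mul_sum]
  refine Finset.sum_le_sum fun j _ => ?_
  calc ‖(∑ k ∈ Finset.range N, D k) i j‖ ^ 2 ≤ (∑ k ∈ Finset.range N, ‖D k i j‖) ^ 2 := by
        rw [Matrix.sum_apply]
        gcongr
        exact norm_sum_le _ _
    _ ≤ _ := by simpa using sq_sum_le_card_mul_sum_sq (s := Finset.range N) (f := fun k => ‖D k i j‖)

/-- In a pair of eigenbases, `tr (f(A) g(B))` is a nonnegative combination of the products of the
values of `f` and `g` at the eigenvalues, with coefficients independent of `f` and `g`. -/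
theorem exists_trace_cfc_mul_cfc (hA : A.IsHermitian) (hB : B.IsHermitian) :
    ∃ p : Fin m → Fin m → ℝ, (∀ i j, 0 ≤ p i j) ∧ ∀ f g : ℝ → ℝ,
      (cfc f A * cfc g B).trace.re =
        ∑ i, ∑ j, p i j * (f (hA.eigenvalues i) * g (hB.eigenvalues j)) := by
  set U := (hA.eigenvectorUnitary : Matrix (Fin m) (Fin m) ℂ) with hU
  set V := (hB.eigenvectorUnitary : Matrix (Fin m) (Fin m) ℂ) with hV
  -- The coefficients are the squared overlaps of the two eigenbases.
  refine ⟨fun i j => ‖(star U * V) i j‖ ^ 2, fun i j => by positivity, fun f g => ?_⟩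
  rw [hA.cfc_eq, hB.cfc_eq]
  simp only [Matrix.IsHermitian.cfc, Unitary.conjStarAlgAut_apply, ← hU, ← hV]
  rw [show U * Matrix.diagonal (RCLike.ofReal ∘ f ∘ hA.eigenvalues) * star U *
      (V * Matrix.diagonal (RCLike.ofReal ∘ g ∘ hB.eigenvalues) * star V) =
      U * (Matrix.diagonal (RCLike.ofReal ∘ f ∘ hA.eigenvalues) * (star U * V) *
        Matrix.diagonal (RCLike.ofReal ∘ g ∘ hB.eigenvalues) * star V) by
      simp only [mul_assoc], Matrix.trace_mul_comm, mul_assoc,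
    show star V * U = (star U * V)ᴴ by
      simp [Matrix.star_eq_conjTranspose, Matrix.conjTranspose_mul]]
  generalize star U * V = W
  simp only [Matrix.trace, Matrix.diag, Matrix.mul_apply (N := Wᴴ), Complex.re_sum,
    Matrix.mul_diagonal, Matrix.diagonal_mul, Matrix.conjTranspose_apply]
  refine Finset.sum_congr rfl fun i _ => Finset.sum_congr rfl fun j _ => ?_
  have key : ∀ a c : ℝ, ∀ b : ℂ, ((a : ℂ) * b * c * star b).re = ‖b‖ ^ 2 * (a * c) := by
    intro a c b
    rw [show (a : ℂ) * b * c * star b = (b * star b) * (a * c) by ring, Complex.star_def,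
      Complex.mul_conj, ← Complex.sq_norm]
    norm_cast
  exact key _ _ _

theorem trace_cfc_re (hA : A.IsHermitian) (f : ℝ → ℝ) :
    (cfc f A).trace.re = ∑ i, f (hA.eigenvalues i) := by
  rw [hA.cfc_eq, Matrix.IsHermitian.cfc, Unitary.conjStarAlgAut_apply, Matrix.trace_mul_comm,
    ← mul_assoc]
  simp [Matrix.trace_diagonal]

/-- From `cosh x = 1 + 2 sinh² (x/2)` and `|sinh y| ≥ |y|`. -/
theorem Real.one_add_sq_div_two_le_cosh (x : ℝ) : 1 + x ^ 2 / 2 ≤ Real.cosh x := by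
  have h : (x / 2) ^ 2 ≤ Real.sinh (x / 2) ^ 2 := by
    rcases le_total 0 (x / 2) with h | h
    · exact pow_le_pow_left₀ h (Real.self_le_sinh_iff.2 h) 2
    · have := pow_le_pow_left₀ (neg_nonneg.2 h) (Real.self_le_sinh_iff.2 (neg_nonneg.2 h)) 2
      rwa [Real.sinh_neg, neg_sq, neg_sq] at this
  rw [show x = 2 * (x / 2) by ring, Real.cosh_two_mul, Real.cosh_sq]
  nlinarith

/-- In the two eigenbases every term becomes a sum against the same coefficients `p i j`, leaving
the scalar inequality `(x - y)² ≤ 2 cosh (x - y) - 2`. The right side agrees with `δ²` to second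
order, so the bound becomes sharp on short geodesic steps. -/
theorem trace_sq_log_sub_log_le (hA : A.PosDef) (hB : B.PosDef) :
    ((matLog A - matLog B) * (matLog A - matLog B)).trace.re
      ≤ (A⁻¹ * B).trace.re + (B⁻¹ * A).trace.re - 2 * m := by
  obtain ⟨p, hp, h⟩ := exists_trace_cfc_mul_cfc hA.1 hB.1
  have hA' : IsSelfAdjoint A := hA.1
  have hB' : IsSelfAdjoint B := hB.1
  have e1 : (A⁻¹ * B).trace.re =
      ∑ i, ∑ j, p i j * ((hA.1.eigenvalues i) ^ (-1 : ℝ) * hB.1.eigenvalues j) := by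
    have := h (fun x => x ^ (-1 : ℝ)) (fun x => x)
    rw [cfc_id' ℝ B] at this
    rw [← matPow_neg_one hA]; exact this
  have e2 : (B⁻¹ * A).trace.re =
      ∑ i, ∑ j, p i j * (hA.1.eigenvalues i * (hB.1.eigenvalues j) ^ (-1 : ℝ)) := by
    have := h (fun x => x) (fun x => x ^ (-1 : ℝ))
    rw [cfc_id' ℝ A] at this
    rw [← matPow_neg_one hB, Matrix.trace_mul_comm]; exact this
  have e3 : (m : ℝ) =
      ∑ i, ∑ j, p i j * (1 * 1) := by
    have := h (fun _ => 1) (fun _ => 1)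
    rw [cfc_const_one ℝ A, cfc_const_one ℝ B] at this
    simpa using this
  have e4 : (matLog A * matLog B).trace.re =
      ∑ i, ∑ j, p i j * (Real.log (hA.1.eigenvalues i) * Real.log (hB.1.eigenvalues j)) := h Real.log Real.log
  -- The idle factors `1` bring single-matrix traces into the common double-sum form.
  have e5 : (matLog A * matLog A).trace.re =
      ∑ i, ∑ j, p i j * (Real.log (hA.1.eigenvalues i) * Real.log (hA.1.eigenvalues i) * 1) := by
    have := h (fun x => Real.log x * Real.log x) (fun _ => 1)
    rw [cfc_const_one ℝ B, mul_one, cfc_mul _ _ A (continuousOn_spectrum _ _)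
      (continuousOn_spectrum _ _)] at this
    exact this
  have e6 : (matLog B * matLog B).trace.re =
      ∑ i, ∑ j, p i j * (1 * (Real.log (hB.1.eigenvalues j) * Real.log (hB.1.eigenvalues j))) := by
    have := h (fun _ => 1) (fun x => Real.log x * Real.log x)
    rw [cfc_const_one ℝ A, one_mul, cfc_mul _ _ B (continuousOn_spectrum _ _)
      (continuousOn_spectrum _ _)] at this
    exact this
  have e7 : (matLog B * matLog A).trace.re = (matLog A * matLog B).trace.re := by
    rw [Matrix.trace_mul_comm]
  simp only [sub_mul, mul_sub, Matrix.trace_sub, Complex.sub_re]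
  rw [e7, e1, e2, e3, e4, e5, e6]
  simp only [Finset.mul_sum, ← Finset.sum_sub_distrib, ← Finset.sum_add_distrib]
  refine Finset.sum_le_sum fun i _ => Finset.sum_le_sum fun j _ => ?_
  have ha := hA.eigenvalues_pos i
  have hb := hB.eigenvalues_pos j
  obtain ⟨x, hx⟩ : ∃ x, x = Real.log (hA.1.eigenvalues i) := ⟨_, rfl⟩
  obtain ⟨y, hy⟩ : ∃ y, y = Real.log (hB.1.eigenvalues j) := ⟨_, rfl⟩
  have hx' : hA.1.eigenvalues i = Real.exp x := by rw [hx, Real.exp_log ha]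
  have hy' : hB.1.eigenvalues j = Real.exp y := by rw [hy, Real.exp_log hb]
  rw [hx', hy', Real.log_exp, Real.log_exp, Real.rpow_neg_one, Real.rpow_neg_one, ← Real.exp_neg,
    ← Real.exp_neg, ← Real.exp_add, ← Real.exp_add]
  have key : (x - y) ^ 2 ≤ Real.exp (-x + y) + Real.exp (x + -y) - 2 := by
    have h1 := Real.one_add_sq_div_two_le_cosh (x - y)
    rw [Real.cosh_eq, show -(x - y) = -x + y by ring, sub_eq_add_neg x y] at h1
    rw [sub_eq_add_neg x y]
    linarith
  nlinarith [mul_le_mul_of_nonneg_left key (hp i j)]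

end Frobenius

/-! ### Exponential metric increasing property -/

section ExponentialMetricIncreasing

variable {m : ℕ} {A B C X : Matrix (Fin m) (Fin m) ℂ}

/-- The weighted geometric mean `X #ₜ A = X^(1/2) (X^(-1/2) A X^(-1/2))^t X^(1/2)`. -/
noncomputable def geomMean (t : ℝ) (X A : Matrix (Fin m) (Fin m) ℂ) : Matrix (Fin m) (Fin m) ℂ :=
  matPow X (1 / 2) * matPow (relMat X A) t * matPow X (1 / 2)

theorem geomMean_posDef (hX : X.PosDef) (hA : A.PosDef) (t : ℝ) : (geomMean t X A).PosDef :=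
  (matPow_posDef (relMat_posDef hX hA) t).conj (matPow_posDef hX _)

theorem geomMean_zero (hX : X.PosDef) (hA : A.PosDef) : geomMean 0 X A = X := by
  rw [geomMean, matPow_zero (relMat_posDef hX hA), mul_one, matPow_half_mul_half hX]

theorem geomMean_one (hX : X.PosDef) (hA : A.PosDef) : geomMean 1 X A = A := by
  rw [geomMean, matPow_one (relMat_posDef hX hA), conj_relMat hX]

/-- Only `t - s` matters, so all steps of an equal subdivision of the geodesic from `X` to `A`
contribute the same amount. -/
theorem trace_inv_geomMean_mul_geomMean (hX : X.PosDef) (hA : A.PosDef) (s t : ℝ) :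
    ((geomMean s X A)⁻¹ * geomMean t X A).trace = (matPow (relMat X A) (t - s)).trace := by
  have hC := relMat_posDef hX hA
  have h : matPow X (-(1 / 2)) * (matPow X (1 / 2) * (matPow (relMat X A) t * matPow X (1 / 2))) =
      matPow (relMat X A) t * matPow X (1 / 2) := by
    rw [← mul_assoc, matPow_neg_mul hX, one_mul]
  simp only [geomMean, Matrix.mul_inv_rev, matPow_inv hX, matPow_inv hC, mul_assoc, h]
  rw [Matrix.trace_mul_comm]
  simp only [mul_assoc, matPow_mul_neg hX, mul_one]
  rw [matPow_mul_matPow hC, neg_add_eq_sub]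

/-- With `h = 1/(N+1)` the expression is the square of `(e^(hx/2) - e^(-hx/2))/h`, a difference
quotient with limit `x`. -/
theorem tendsto_sq_mul_exp_add_exp_neg_sub_two (x : ℝ) :
    Filter.Tendsto (fun N : ℕ => ((N : ℝ) + 1) ^ 2 *
      (Real.exp (1 / ((N : ℝ) + 1) * x) + Real.exp (-(1 / ((N : ℝ) + 1)) * x) - 2))
      Filter.atTop (nhds (x ^ 2)) := by
  have h1 : HasDerivAt (fun h : ℝ => Real.exp (h * (x / 2)) - Real.exp (h * (-(x / 2)))) x 0 := by
    have := (((hasDerivAt_id (0 : ℝ)).mul_const (x / 2)).exp).sub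
      (((hasDerivAt_id (0 : ℝ)).mul_const (-(x / 2))).exp)
    refine HasDerivAt.congr_deriv this ?_
    simp
  have h2 := h1.tendsto_slope_zero_right
  have h3 : Filter.Tendsto (fun N : ℕ => 1 / ((N : ℝ) + 1)) Filter.atTop (nhdsWithin 0 (Set.Ioi 0)) :=
    tendsto_nhdsWithin_iff.2 ⟨tendsto_one_div_add_atTop_nhds_zero_nat,
      Filter.Eventually.of_forall fun N => by simp only [Set.mem_Ioi]; positivity⟩
  refine ((h2.comp h3).pow 2).congr fun N => ?_
  have hN : (N : ℝ) + 1 ≠ 0 := by positivity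
  simp only [Function.comp_apply, zero_add, zero_mul, Real.exp_zero, sub_self, sub_zero, smul_eq_mul,
    one_div, inv_inv]
  rw [mul_pow, sub_sq, ← Real.exp_nat_mul, ← Real.exp_nat_mul, mul_assoc 2, ← Real.exp_add]
  rw [show ((N : ℝ) + 1)⁻¹ * (x / 2) + ((N : ℝ) + 1)⁻¹ * -(x / 2) = 0 by ring, Real.exp_zero]
  congr 1
  push_cast
  ring_nf

/-- The exponential metric increasing property. -/
theorem trace_sq_log_sub_log_le_log_relMat (hA : A.PosDef) (hB : B.PosDef) :
    ((matLog B - matLog A) * (matLog B - matLog A)).trace.re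
      ≤ (matLog (relMat A B) * matLog (relMat A B)).trace.re := by
  have hC := relMat_posDef hA hB
  have hR : (matLog (relMat A B) * matLog (relMat A B)).trace.re =
      ∑ i, Real.log (hC.1.eigenvalues i) ^ 2 := by
    rw [matLog, ← cfc_mul _ _ _ (continuousOn_spectrum _ _) (continuousOn_spectrum _ _),
      trace_cfc_re hC.1]
    simp only [sq]
  rw [hR]
  refine ge_of_tendsto' (tendsto_finsetSum _ fun i _ =>
    tendsto_sq_mul_exp_add_exp_neg_sub_two (Real.log (hC.1.eigenvalues i))) fun N => ?_
  have hN : ((N : ℝ) + 1) ≠ 0 := by positivity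
  have hT : ∀ t : ℝ, (matPow (relMat A B) t).trace.re =
      ∑ i, Real.exp (t * Real.log (hC.1.eigenvalues i)) := by
    intro t
    rw [matPow, trace_cfc_re hC.1]
    exact Finset.sum_congr rfl fun i _ => by
      rw [Real.rpow_def_of_pos (hC.eigenvalues_pos i), mul_comm]
  -- Telescoping over `N + 1` equal steps of the geodesic. Cauchy–Schwarz and the number of equal
  -- steps each supply a factor `N + 1`, matching the `(N + 1)²` of the limit.
  have hsum : matLog B - matLog A = ∑ k ∈ Finset.range (N + 1),
      (matLog (geomMean ((k + 1 : ℕ) / ((N : ℝ) + 1)) A B) -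
        matLog (geomMean ((k : ℕ) / ((N : ℝ) + 1)) A B)) := by
    rw [Finset.sum_range_sub (fun k : ℕ => matLog (geomMean ((k : ℕ) / ((N : ℝ) + 1)) A B))]
    push_cast
    rw [div_self hN, zero_div, geomMean_zero hA hB, geomMean_one hA hB]
  rw [hsum]
  refine (trace_mul_self_sum_le _ fun k => (matLog_isHermitian _).sub (matLog_isHermitian _)).trans ?_
  have hstep : ∀ k ∈ Finset.range (N + 1),
      ((matLog (geomMean ((k + 1 : ℕ) / ((N : ℝ) + 1)) A B) -
        matLog (geomMean ((k : ℕ) / ((N : ℝ) + 1)) A B)) *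
       (matLog (geomMean ((k + 1 : ℕ) / ((N : ℝ) + 1)) A B) -
        matLog (geomMean ((k : ℕ) / ((N : ℝ) + 1)) A B))).trace.re ≤
      ∑ i, (Real.exp (1 / ((N : ℝ) + 1) * Real.log (hC.1.eigenvalues i)) +
        Real.exp (-(1 / ((N : ℝ) + 1)) * Real.log (hC.1.eigenvalues i)) - 2) := by
    intro k _
    refine (trace_sq_log_sub_log_le (geomMean_posDef hA hB _) (geomMean_posDef hA hB _)).trans ?_
    rw [trace_inv_geomMean_mul_geomMean hA hB, trace_inv_geomMean_mul_geomMean hA hB, hT, hT,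
      show (k : ℝ) / ((N : ℝ) + 1) - (k + 1 : ℕ) / ((N : ℝ) + 1) = -(1 / ((N : ℝ) + 1)) by
        push_cast; ring,
      show ((k + 1 : ℕ) : ℝ) / ((N : ℝ) + 1) - k / ((N : ℝ) + 1) = 1 / ((N : ℝ) + 1) by
        push_cast; ring]
    simp only [Finset.sum_sub_distrib, Finset.sum_add_distrib, Finset.sum_const, Finset.card_univ,
      Fintype.card_fin, nsmul_eq_mul]
    linarith
  have := mul_le_mul_of_nonneg_left (Finset.sum_le_sum hstep) (Nat.cast_nonneg (α := ℝ) (N + 1))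
  refine this.trans (le_of_eq ?_)
  rw [Finset.sum_const, Finset.card_range, nsmul_eq_mul, ← mul_assoc, Finset.mul_sum]
  push_cast
  simp only [sq]

end ExponentialMetricIncreasing

/-! ### Karcher equation and variance inequality -/

section Karcher

variable {m n : ℕ}

theorem riemDist_sq (X A : PDCone m) :
    riemDist X A ^ 2 = (matLog (relMat X.1 A.1) * matLog (relMat X.1 A.1)).trace.re :=
  frobNorm_sq (matLog_isHermitian _)

theorem matLog_unitary_conj {A U : Matrix (Fin m) (Fin m) ℂ} (hA : A.IsHermitian)
    (hU : U ∈ unitary (Matrix (Fin m) (Fin m) ℂ)) :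
    matLog (U * A * star U) = U * matLog A * star U :=
  cfc_unitary_conj hU hA _

theorem riemDist_sq_congruence (M : GL (Fin m) ℂ) (X A : PDCone m) :
    riemDist (X.congruence M) (A.congruence M) ^ 2 = riemDist X A ^ 2 := by
  obtain ⟨V, hV, h⟩ := exists_unitary_relMat_congr X.2 M.isUnit A.1
  have hV' : star V * V = 1 := hV.1
  rw [riemDist_sq, riemDist_sq]
  simp only [PDCone.congruence]
  rw [h, matLog_unitary_conj (relMat_posDef X.2 A.2).1 hV]
  rw [show ∀ L, V * L * star V * (V * L * star V) = V * (L * (star V * V) * L * star V) by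
    intro L; simp only [mul_assoc], Matrix.trace_mul_comm, hV', mul_one, mul_assoc, mul_assoc, hV',
    mul_one]

theorem riemDist_sq_le_of_one (Y A : PDCone m) :
    ((matLog A.1 - matLog Y.1) * (matLog A.1 - matLog Y.1)).trace.re ≤ riemDist Y A ^ 2 := by
  rw [riemDist_sq]
  exact trace_sq_log_sub_log_le_log_relMat Y.2 A.2

theorem eq_of_riemDist_sq_le_zero {X Y : PDCone m} (h : riemDist X Y ^ 2 ≤ 0) : X = Y := by
  rw [riemDist_sq] at h
  have h0 := (matLog_isHermitian _).eq_zero_of_trace_mul_self h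
  have h1 := exp_matLog (relMat_posDef X.2 Y.2)
  rw [h0, NormedSpace.exp_zero] at h1
  have h2 := conj_relMat X.2 Y.1
  rw [← h1, mul_one, matPow_half_mul_half X.2] at h2
  exact Subtype.ext h2

/-- The Karcher equation `∑ wᵢ log (X^(-1/2) Aᵢ X^(-1/2)) = 0`. -/
def IsKarcherPoint (w : Fin n → ℝ) (A : Fin n → PDCone m) (X : PDCone m) : Prop :=
  ∑ i, w i • matLog (relMat X.1 (A i).1) = 0

/-- Congruence by `X^(-1/2)` moves `X` to the identity. There the metric increasing property bounds
`‖log Aᵢ - log Y‖²` by `δ(Y, Aᵢ)²`; in the weighted sum of the expanded squares the cross term is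
zero by the Karcher equation. -/
theorem IsKarcherPoint.variance_inequality {w : Fin n → ℝ} {A : Fin n → PDCone m} {X : PDCone m}
    (h : IsKarcherPoint w A X) (hw : ∀ i, 0 ≤ w i) (hw1 : ∑ i, w i = 1) (Y : PDCone m) :
    ∑ i, w i * riemDist X (A i) ^ 2 + riemDist X Y ^ 2 ≤ ∑ i, w i * riemDist Y (A i) ^ 2 := by
  obtain ⟨M, hM⟩ : ∃ M : GL (Fin m) ℂ, M.1 = matPow X.1 (-1 / 2) :=
    ⟨(matPow_posDef X.2 _).isUnit.unit, rfl⟩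
  have hc : ∀ B : PDCone m, (B.congruence M).1 = relMat X.1 B.1 := fun B => by
    simp only [PDCone.congruence, hM, (matPow_isHermitian _ _).eq, relMat]
  have hle : ∀ i, w i * riemDist X (A i) ^ 2 + w i * riemDist X Y ^ 2 -
      2 * (matLog (relMat X.1 Y.1) * (w i • matLog (relMat X.1 (A i).1))).trace.re ≤
      w i * riemDist Y (A i) ^ 2 := by
    intro i
    have h1 := riemDist_sq_le_of_one (Y.congruence M) ((A i).congruence M)
    rw [riemDist_sq_congruence, hc, hc] at h1
    have h2 := mul_le_mul_of_nonneg_left h1 (hw i)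
    refine le_trans (le_of_eq ?_) h2
    rw [riemDist_sq X, riemDist_sq X]
    simp only [sub_mul, mul_sub, Matrix.trace_sub, Complex.sub_re, mul_smul_comm, Matrix.trace_smul,
      Complex.real_smul, Complex.re_ofReal_mul]
    rw [Matrix.trace_mul_comm (matLog (relMat X.1 (A i).1)) (matLog (relMat X.1 Y.1))]
    ring
  have hsum := Finset.sum_le_sum fun i (_ : i ∈ Finset.univ) => hle i
  rw [Finset.sum_sub_distrib, Finset.sum_add_distrib, ← Finset.sum_mul, hw1, one_mul,
    ← Finset.mul_sum, ← Complex.re_sum, ← Matrix.trace_sum, ← Finset.mul_sum,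
    show ∑ i, w i • matLog (relMat X.1 (A i).1) = 0 from h] at hsum
  simpa using hsum

theorem IsKarcherPoint.isWeightedLeastSquaresPoint_iff {w : Weight n} {A : Fin n → PDCone m}
    {X : PDCone m} (h : IsKarcherPoint w.1 A X) (Y : PDCone m) :
    IsWeightedLeastSquaresPoint w A Y ↔ Y = X := by
  have hv := h.variance_inequality (fun i => (w.2.1 i).1.le) w.2.2
  constructor
  · intro hY
    have h1 := hY X
    have h2 := hv Y
    exact (eq_of_riemDist_sq_le_zero (by linarith)).symm
  · rintro rfl Z
    have := hv Z
    nlinarith [sq_nonneg (riemDist Y Z)]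

theorem IsKarcherPoint.unique {w : Weight n} {A : Fin n → PDCone m} {X Y : PDCone m}
    (hX : IsKarcherPoint w.1 A X) (hY : IsKarcherPoint w.1 A Y) : X = Y :=
  (hY.isWeightedLeastSquaresPoint_iff X).1 ((hX.isWeightedLeastSquaresPoint_iff X).2 rfl)

theorem IsKarcherPoint.eq_weightedLeastSquaresMean {w : Weight n} {A : Fin n → PDCone m}
    {X : PDCone m} (h : IsKarcherPoint w.1 A X) : X = weightedLeastSquaresMean w A := by
  refine ((h.isWeightedLeastSquaresPoint_iff _).1 ?_).symm
  exact Classical.epsilon_spec (p := IsWeightedLeastSquaresPoint w A)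
    ⟨X, (h.isWeightedLeastSquaresPoint_iff X).2 rfl⟩

end Karcher

/-! ### Monotonicity and concavity of dyadic geometric means -/

section GeometricMean

variable {m : ℕ} {A B X Y : Matrix (Fin m) (Fin m) ℂ}

/-- Reduces exponent `2^(-k)` to iterated halving, which is why only dyadic exponents are used. -/
theorem geomMean_half_geomMean (hX : X.PosDef) (hA : A.PosDef) (t : ℝ) :
    geomMean (1 / 2) X (geomMean t X A) = geomMean (t * (1 / 2)) X A := by
  rw [geomMean, geomMean, relMat_conj hX, matPow_matPow (relMat_posDef hX hA), geomMean]

theorem geomMean_self (hX : X.PosDef) (t : ℝ) : geomMean t X X = X := by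
  have h1 : matPow (1 : Matrix (Fin m) (Fin m) ℂ) t = 1 := by simp [matPow]
  rw [geomMean, relMat_self hX, h1, mul_one, matPow_half_mul_half hX]

theorem geomMean_smul_left (hX : X.PosDef) (hA : A.PosDef) {r : ℝ} (hr : 0 < r) (t : ℝ) :
    geomMean t (r • X) A = r ^ (1 - t) • geomMean t X A := by
  have h := relMat_smul hX A hr 1
  rw [one_smul, mul_one] at h
  rw [geomMean, h, matPow_smul (relMat_posDef hX hA) (inv_pos.2 hr), matPow_smul hX hr, geomMean]
  simp only [smul_mul_assoc, mul_smul_comm, smul_smul]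
  congr 1
  rw [← Real.rpow_neg_one r, ← Real.rpow_mul hr.le, mul_comm, ← Real.rpow_add hr,
    ← Real.rpow_add hr]
  ring_nf

theorem geomMean_half_mul_inv_mul (hX : X.PosDef) (hA : A.PosDef) :
    geomMean (1 / 2) X A * X⁻¹ * geomMean (1 / 2) X A = A := by
  have hC := relMat_posDef hX hA
  conv_rhs => rw [← conj_relMat hX A, ← matPow_half_mul_half hC]
  rw [← matPow_neg_half_mul_neg_half hX, geomMean]
  have h : ∀ Z, matPow X (1 / 2) * (matPow X (-1 / 2) * Z) = Z := fun Z => by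
    rw [← mul_assoc, matPow_half_mul_neg_half hX, one_mul]
  have h' : ∀ Z, matPow X (-1 / 2) * (matPow X (1 / 2) * Z) = Z := fun Z => by
    rw [← mul_assoc, matPow_neg_half_mul_half hX, one_mul]
  simp only [mul_assoc, h, h']

theorem Matrix.IsHermitian.le_matPow_mul_self (hA : A.IsHermitian) :
    A ≤ matPow (A * A) (1 / 2) := by
  have hA' : IsSelfAdjoint A := hA
  have h : matPow (A * A) (1 / 2) = cfc (fun x : ℝ => (x * x) ^ (1 / 2 : ℝ)) A := by
    unfold matPow
    rw [cfc_comp' (fun x : ℝ => x ^ (1 / 2 : ℝ)) (fun x => x * x) A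
      ((Matrix.finite_real_spectrum.image _).continuousOn _) (continuousOn_spectrum _ _),
      cfc_mul _ _ A (continuousOn_spectrum _ _) (continuousOn_spectrum _ _), cfc_id' ℝ A]
  rw [h]
  conv_lhs => rw [← cfc_id' ℝ A]
  refine cfc_mono (fun x _ => ?_) (continuousOn_spectrum _ _) (continuousOn_spectrum _ _)
  rw [← Real.sqrt_eq_rpow, Real.sqrt_mul_self_eq_abs]
  exact le_abs_self x

/-- Maximality of `X # A` among hermitian solutions of the Riccati inequality. Seen from `X` it
reads `Z² ≤ C ⟹ Z ≤ |Z| ≤ C^(1/2)`, by operator monotonicity of the square root. -/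
theorem le_geomMean_half (hX : X.PosDef) (hY : Y.IsHermitian) (h : Y * X⁻¹ * Y ≤ A) :
    Y ≤ geomMean (1 / 2) X A := by
  have hZ : (relMat X Y).IsHermitian := by
    have := Matrix.isHermitian_conjTranspose_mul_mul (matPow X (-1 / 2)) hY
    rwa [(matPow_isHermitian _ _).eq] at this
  have h1 : relMat X Y * relMat X Y ≤ relMat X A := by
    have := relMat_mono X h
    rw [← matPow_neg_half_mul_neg_half hX] at this
    simpa only [relMat, mul_assoc] using this
  have h2 : 0 ≤ relMat X Y * relMat X Y := by
    have := (Matrix.posSemidef_conjTranspose_mul_self (relMat X Y)).nonneg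
    rwa [hZ.eq] at this
  have h3 := hZ.le_matPow_mul_self.trans (matPow_mono (by norm_num) (by norm_num) h2 h1)
  have h4 := (matPow_isHermitian X (1 / 2)).conj_le_conj h3
  rwa [conj_relMat hX] at h4

/-- The Schur complement makes the Riccati inequality linear in `(X, Y, A)` jointly, so it survives
nonnegative combinations. -/
theorem mul_inv_mul_le_iff_posSemidef_fromBlocks (hX : X.PosDef) (hY : Y.IsHermitian) :
    Y * X⁻¹ * Y ≤ A ↔ (Matrix.fromBlocks X Y Y A).PosSemidef := by
  have : Invertible X := hX.isUnit.invertible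
  have := Matrix.PosDef.fromBlocks₁₁ Y A hX
  rw [hY.eq] at this
  rw [this, Matrix.le_iff]

/-- Joint monotonicity and joint concavity of the geometric mean of two matrices. -/
theorem smul_geomMean_half_add_le {X₁ X₂ A₁ A₂ : Matrix (Fin m) (Fin m) ℂ} (hX₁ : X₁.PosDef)
    (hX₂ : X₂.PosDef) (hA₁ : A₁.PosDef) (hA₂ : A₂.PosDef) (hX : X.PosDef) {s t : ℝ}
    (hs : 0 ≤ s) (ht : 0 ≤ t) (hXle : s • X₁ + t • X₂ ≤ X) (hAle : s • A₁ + t • A₂ ≤ A) :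
    s • geomMean (1 / 2) X₁ A₁ + t • geomMean (1 / 2) X₂ A₂ ≤ geomMean (1 / 2) X A := by
  have hG₁ := (geomMean_posDef hX₁ hA₁ (1 / 2)).1
  have hG₂ := (geomMean_posDef hX₂ hA₂ (1 / 2)).1
  have hr : ∀ {r : ℝ} {G : Matrix (Fin m) (Fin m) ℂ}, G.IsHermitian → (r • G).IsHermitian := by
    intro r G hG
    rw [Matrix.IsHermitian, Matrix.conjTranspose_smul, hG.eq, star_trivial]
  have hG : (s • geomMean (1 / 2) X₁ A₁ + t • geomMean (1 / 2) X₂ A₂).IsHermitian :=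
    (hr hG₁).add (hr hG₂)
  refine le_geomMean_half hX hG ((mul_inv_mul_le_iff_posSemidef_fromBlocks hX hG).2 ?_)
  have h1 := (mul_inv_mul_le_iff_posSemidef_fromBlocks hX₁ hG₁).1
    (geomMean_half_mul_inv_mul hX₁ hA₁).le
  have h2 := (mul_inv_mul_le_iff_posSemidef_fromBlocks hX₂ hG₂).1
    (geomMean_half_mul_inv_mul hX₂ hA₂).le
  -- The slack in the two hypotheses, added to the combined block matrices to reach `X` and `A`.
  have h3 : (Matrix.fromBlocks (X - (s • X₁ + t • X₂)) 0 0
      (A - (s • A₁ + t • A₂))).PosSemidef := by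
    rw [Matrix.le_iff] at hXle hAle
    refine Matrix.PosSemidef.of_dotProduct_mulVec_nonneg ?_ fun x => ?_
    · exact Matrix.IsHermitian.fromBlocks hXle.1 (by simp) hAle.1
    · rw [← Sum.elim_comp_inl_inr x, Matrix.fromBlocks_mulVec]
      simp only [Matrix.zero_mulVec, add_zero, zero_add, Sum.elim_comp_inl, Sum.elim_comp_inr]
      have := add_nonneg (hXle.dotProduct_mulVec_nonneg (x ∘ Sum.inl))
        (hAle.dotProduct_mulVec_nonneg (x ∘ Sum.inr))
      simpa [dotProduct, Fintype.sum_sum_type] using this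
  convert (h3.add ((h1.smul hs).add (h2.smul ht))) using 1
  simp only [Matrix.fromBlocks_smul, Matrix.fromBlocks_add, zero_add, sub_add_cancel]

theorem smul_geomMean_add_le (k : ℕ) {X₁ X₂ A₁ A₂ : Matrix (Fin m) (Fin m) ℂ} (hX₁ : X₁.PosDef)
    (hX₂ : X₂.PosDef) (hA₁ : A₁.PosDef) (hA₂ : A₂.PosDef) (hX : X.PosDef) (hA : A.PosDef) {s t : ℝ}
    (hs : 0 ≤ s) (ht : 0 ≤ t) (hXle : s • X₁ + t • X₂ ≤ X) (hAle : s • A₁ + t • A₂ ≤ A) :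
    s • geomMean ((1 / 2) ^ k) X₁ A₁ + t • geomMean ((1 / 2) ^ k) X₂ A₂ ≤
      geomMean ((1 / 2) ^ k) X A := by
  induction k with
  | zero => simpa only [pow_zero, geomMean_one, hX₁, hX₂, hX, hA₁, hA₂, hA] using hAle
  | succ k ih =>
    rw [pow_succ, ← geomMean_half_geomMean hX hA, ← geomMean_half_geomMean hX₁ hA₁,
      ← geomMean_half_geomMean hX₂ hA₂]
    exact smul_geomMean_half_add_le hX₁ hX₂ (geomMean_posDef hX₁ hA₁ _)
      (geomMean_posDef hX₂ hA₂ _) hX hs ht hXle ih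

theorem geomMean_mono (k : ℕ) {X' A' : Matrix (Fin m) (Fin m) ℂ} (hX : X.PosDef) (hA : A.PosDef)
    (hXle : X ≤ X') (hAle : A ≤ A') :
    geomMean ((1 / 2) ^ k) X A ≤ geomMean ((1 / 2) ^ k) X' A' := by
  -- Coefficients `1` and `0`: the second pair is a dummy.
  have := smul_geomMean_add_le k hX hX hA hA (hX.of_le hXle) (hA.of_le hAle) zero_le_one le_rfl
    (by simpa using hXle) (by simpa using hAle)
  simpa using this

end GeometricMean

/-! ### Continuity and compact order intervals in the cone -/

section Topology

open scoped Matrix.Norms.L2Operator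

variable {m : ℕ}

theorem PDCone.continuous_matPow (t : ℝ) : Continuous fun A : PDCone m => matPow A.1 t :=
  continuousOn_iff_continuous_domRestrict.1 (continuousOn_matPow t)

theorem PDCone.continuous_matLog : Continuous fun A : PDCone m => matLog A.1 :=
  continuousOn_iff_continuous_domRestrict.1 continuousOn_matLog

/-- `relMat` as an element of the cone. -/
noncomputable def PDCone.rel (X A : PDCone m) : PDCone m := ⟨relMat X.1 A.1, relMat_posDef X.2 A.2⟩

theorem PDCone.continuous_rel : Continuous fun p : PDCone m × PDCone m => p.1.rel p.2 := by
  refine Continuous.subtype_mk ?_ _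
  have h : Continuous fun p : PDCone m × PDCone m => matPow p.1.1 (-1 / 2) :=
    (PDCone.continuous_matPow (-1 / 2)).comp continuous_fst
  exact (h.mul (continuous_subtype_val.comp continuous_snd)).mul h

/-- The lower bound `c > 0` keeps the whole matrix interval inside the cone, so closed and bounded
suffices. -/
theorem PDCone.isCompact_bounds (c C : ℝ) (hc : 0 < c) :
    IsCompact {X : PDCone m | c • (1 : Matrix (Fin m) (Fin m) ℂ) ≤ X.1 ∧ X.1 ≤ C • 1} := by
  rw [Subtype.isCompact_iff]
  have h : Subtype.val '' {X : PDCone m | c • (1 : Matrix (Fin m) (Fin m) ℂ) ≤ X.1 ∧ X.1 ≤ C • 1} =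
      Set.Icc (c • (1 : Matrix (Fin m) (Fin m) ℂ)) (C • 1) := by
    ext X
    constructor
    · rintro ⟨X, hX, rfl⟩
      exact hX
    · intro hX
      exact ⟨⟨X, (Matrix.PosDef.one.smul hc).of_le hX.1⟩, hX, rfl⟩
  rw [h]
  have : ProperSpace (Matrix (Fin m) (Fin m) ℂ) := FiniteDimensional.proper ℂ _
  refine Metric.isCompact_of_isClosed_isBounded isClosed_Icc ?_
  refine (Metric.isBounded_closedBall (x := 0) (r := ‖C • (1 : Matrix (Fin m) (Fin m) ℂ)‖)).subset ?_
  intro X hX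
  rw [mem_closedBall_zero_iff]
  exact CStarAlgebra.norm_le_norm_of_nonneg_of_le
    (ha := (Matrix.PosDef.one.smul hc).posSemidef.nonneg.trans hX.1) (hab := hX.2)

theorem PDCone.exists_smul_one_le (A : PDCone m) : ∃ c : ℝ, 0 < c ∧ c • 1 ≤ A.1 := by
  -- The matrix algebra is trivial when `m = 0`.
  by_cases hm : Nontrivial (Matrix (Fin m) (Fin m) ℂ)
  · obtain ⟨c, hc, h⟩ := (CFC.exists_pos_algebraMap_le_iff (a := A.1) A.2.1).2
      fun x hx => A.2.spectrum_pos hx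
    exact ⟨c, hc, by rwa [Algebra.algebraMap_eq_smul_one] at h⟩
  · rw [not_nontrivial_iff_subsingleton] at hm
    exact ⟨1, one_pos, le_of_eq (Subsingleton.elim _ _)⟩

theorem PDCone.exists_le_smul_one (A : PDCone m) : ∃ C : ℝ, 0 < C ∧ A.1 ≤ C • 1 := by
  refine ⟨‖A.1‖ + 1, by positivity, ?_⟩
  have h := IsSelfAdjoint.le_algebraMap_norm_self (a := A.1) A.2.1
  rw [Algebra.algebraMap_eq_smul_one] at h
  refine h.trans ?_
  rw [add_smul]
  exact le_add_of_nonneg_right (Matrix.PosDef.one.smul one_pos).posSemidef.nonneg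

theorem real_smul_one_le_smul_one {a b : ℝ} (h : a ≤ b) :
    a • (1 : Matrix (Fin m) (Fin m) ℂ) ≤ b • 1 := by
  rw [Matrix.le_iff, ← sub_smul]
  exact Matrix.PosSemidef.one.smul (sub_nonneg.2 h)

theorem PDCone.exists_bounds {n : ℕ} (A : Fin n → PDCone m) :
    ∃ c C : ℝ, 0 < c ∧ 0 < C ∧ c ≤ C ∧
      ∀ i, c • (1 : Matrix (Fin m) (Fin m) ℂ) ≤ (A i).1 ∧ (A i).1 ≤ C • 1 := by
  choose c hc hcA using fun i => (A i).exists_smul_one_le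
  choose C hC hCA using fun i => (A i).exists_le_smul_one
  obtain ⟨c', hc', hle⟩ : ∃ c' : ℝ, 0 < c' ∧ ∀ i, c' ≤ c i := by
    rcases isEmpty_or_nonempty (Fin n) with _ | _
    · exact ⟨1, one_pos, fun i => isEmptyElim i⟩
    · obtain ⟨i, hi⟩ := Finite.exists_min c
      exact ⟨c i, hc i, hi⟩
  -- The summand `c'` makes the upper constant positive and at least `c'` even when `n = 0`.
  have hCs : ∀ i, C i ≤ c' + ∑ j, C j := fun i =>
    (Finset.single_le_sum (fun j _ => (hC j).le) (Finset.mem_univ i)).trans (by linarith)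
  have h0 : 0 ≤ ∑ j, C j := Finset.sum_nonneg fun j _ => (hC j).le
  exact ⟨c', c' + ∑ j, C j, hc', by linarith, by linarith, fun i =>
    ⟨(real_smul_one_le_smul_one (hle i)).trans (hcA i), (hCA i).trans (real_smul_one_le_smul_one (hCs i))⟩⟩

end Topology

/-! ### Power mean equations: comparison and fixed points -/

section PowerMap

open scoped Matrix.Norms.L2Operator

variable {m n : ℕ}

/-- The map `X ↦ ∑ wᵢ (X #ₜ Aᵢ)` with `t = 2^(-k)`, whose fixed point is the weighted power mean of
exponent `t`. -/
noncomputable def powerMap (k : ℕ) (w : Fin n → ℝ) (A : Fin n → PDCone m) (X : PDCone m) :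
    Matrix (Fin m) (Fin m) ℂ :=
  ∑ i, w i • geomMean ((1 / 2) ^ k) X.1 (A i).1

theorem sum_smul_le_sum_smul {w : Fin n → ℝ} (hw : ∀ i, 0 ≤ w i)
    {F G : Fin n → Matrix (Fin m) (Fin m) ℂ} (h : ∀ i, F i ≤ G i) :
    ∑ i, w i • F i ≤ ∑ i, w i • G i :=
  Finset.sum_le_sum fun i _ => smul_le_smul_of_nonneg_left (h i) (hw i)

theorem powerMap_mono (k : ℕ) {w : Fin n → ℝ} (hw : ∀ i, 0 ≤ w i) {A B : Fin n → PDCone m}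
    {X Y : PDCone m} (hA : ∀ i, (A i).1 ≤ (B i).1) (h : X.1 ≤ Y.1) :
    powerMap k w A X ≤ powerMap k w B Y :=
  sum_smul_le_sum_smul hw fun i => geomMean_mono k X.2 (A i).2 h (hA i)

/-- Homogeneity of degree `1 - 2^(-k) < 1` is the contraction behind the comparison principle. -/
theorem powerMap_scale (k : ℕ) (w : Fin n → ℝ) (A : Fin n → PDCone m) (X : PDCone m)
    (r : {r : ℝ // 0 < r}) :
    powerMap k w A (X.scale r) = r.1 ^ (1 - (1 / 2 : ℝ) ^ k) • powerMap k w A X := by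
  simp only [powerMap, PDCone.scale, geomMean_smul_left X.2 (A _).2 r.2, Finset.smul_sum]
  exact Finset.sum_congr rfl fun i _ => smul_comm _ _ _

theorem powerMap_const (k : ℕ) {w : Fin n → ℝ} (hw : ∑ i, w i = 1) (X : PDCone m) :
    powerMap k w (fun _ => X) X = X.1 := by
  simp only [powerMap, geomMean_self X.2, ← Finset.sum_smul, hw, one_smul]

theorem PDCone.continuous_geomMean (t : ℝ) (A : PDCone m) :
    Continuous fun X : PDCone m => geomMean t X.1 A.1 := by
  have h1 := PDCone.continuous_matPow (m := m) (1 / 2)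
  have h2 : Continuous fun X : PDCone m => matPow (relMat X.1 A.1) t :=
    (PDCone.continuous_matPow t).comp
      (PDCone.continuous_rel.comp (continuous_id.prodMk continuous_const))
  simp only [geomMean]
  exact (h1.mul h2).mul h1

theorem continuous_powerMap (k : ℕ) (w : Fin n → ℝ) (A : Fin n → PDCone m) :
    Continuous (powerMap k w A) :=
  continuous_finsetSum _ fun i _ =>
    (PDCone.continuous_geomMean ((1 / 2) ^ k) (A i)).const_smul (w i)

/-- Comparison principle: subsolutions lie below supersolutions. -/
theorem le_of_le_powerMap_of_powerMap_le (k : ℕ) {w : Fin n → ℝ} (hw : ∀ i, 0 ≤ w i)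
    {A : Fin n → PDCone m} {X Y : PDCone m} (hX : X.1 ≤ powerMap k w A X)
    (hY : powerMap k w A Y ≤ Y.1) : X.1 ≤ Y.1 := by
  obtain ⟨a, ha, hXa⟩ : ∃ a : ℝ, 0 < a ∧ X.1 ≤ a • Y.1 := by
    obtain ⟨C, hC, hXC⟩ := X.exists_le_smul_one
    obtain ⟨c, hc, hYc⟩ := Y.exists_smul_one_le
    refine ⟨C / c, by positivity, hXC.trans ?_⟩
    have := smul_le_smul_of_nonneg_left hYc (show 0 ≤ C / c by positivity)
    rwa [smul_smul, div_mul_cancel₀ _ hc.ne'] at this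
  set q : ℝ := 1 - (1 / 2 : ℝ) ^ k with hq
  have hq0 : 0 ≤ q := sub_nonneg.2 (pow_le_one₀ (by norm_num) (by norm_num))
  have hq1 : q < 1 := sub_lt_self _ (by positivity)
  -- Each application of the map raises the constant in `X ≤ a Y` to the power `q`, so it tends to
  -- `1`.
  have hj : ∀ j : ℕ, X.1 ≤ a ^ (q ^ j) • Y.1 := by
    intro j
    induction j with
    | zero => simpa using hXa
    | succ j ih =>
      have hr : 0 < a ^ (q ^ j) := Real.rpow_pos_of_pos ha _
      have h1 := hX.trans (powerMap_mono (Y := Y.scale ⟨_, hr⟩) k hw (fun _ => le_rfl) ih)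
      rw [powerMap_scale, ← hq, ← Real.rpow_mul ha.le, ← pow_succ] at h1
      exact h1.trans (smul_le_smul_of_nonneg_left hY (Real.rpow_pos_of_pos ha _).le)
  have hlim : Filter.Tendsto (fun j : ℕ => a ^ (q ^ j) • Y.1) Filter.atTop (nhds (a ^ (0 : ℝ) • Y.1)) :=
    (((Real.continuous_const_rpow ha.ne').tendsto 0).comp
      (tendsto_pow_atTop_nhds_zero_of_lt_one hq0 hq1)).smul_const _
  rw [Real.rpow_zero, one_smul] at hlim
  exact ge_of_tendsto' hlim hj

/-- Iterating from `C • 1` gives a decreasing sequence in a compact order interval; a subsequential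
limit is a fixed point. -/
theorem exists_powerMap_eq (k : ℕ) {w : Fin n → ℝ} (hw : ∀ i, 0 ≤ w i) (hw1 : ∑ i, w i = 1)
    {A : Fin n → PDCone m} {c C : ℝ} (hc : 0 < c) (hcC : c ≤ C)
    (hA : ∀ i, c • (1 : Matrix (Fin m) (Fin m) ℂ) ≤ (A i).1 ∧ (A i).1 ≤ C • 1) :
    ∃ X : PDCone m, (c • (1 : Matrix (Fin m) (Fin m) ℂ) ≤ X.1 ∧ X.1 ≤ C • 1) ∧
      powerMap k w A X = X.1 := by
  have hC : 0 < C := hc.trans_le hcC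
  set Lo : PDCone m := PDCone.one.scale ⟨c, hc⟩ with hLo
  set Hi : PDCone m := PDCone.one.scale ⟨C, hC⟩ with hHi
  have hlow : ∀ X : PDCone m, Lo.1 ≤ X.1 → Lo.1 ≤ powerMap k w A X := fun X hX => by
    conv_lhs => rw [← powerMap_const k hw1 Lo]
    exact powerMap_mono k hw (fun i => (hA i).1) hX
  have hhigh : ∀ X : PDCone m, X.1 ≤ Hi.1 → powerMap k w A X ≤ Hi.1 := fun X hX => by
    conv_rhs => rw [← powerMap_const k hw1 Hi]
    exact powerMap_mono k hw (fun i => (hA i).2) hX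
  let K := {X : PDCone m // Lo.1 ≤ X.1 ∧ X.1 ≤ Hi.1}
  let F : K → K := fun X => ⟨⟨powerMap k w A X.1, Lo.2.of_le (hlow _ X.2.1)⟩,
    hlow _ X.2.1, hhigh _ X.2.2⟩
  let x : ℕ → K := fun j => F^[j] ⟨Hi, real_smul_one_le_smul_one hcC, le_rfl⟩
  have hx : ∀ j, (x (j + 1)).1.1 = powerMap k w A (x j).1 := fun j => by
    simp only [x, Function.iterate_succ_apply']
    rfl
  have hanti : Antitone fun j => (x j).1.1 := by
    refine antitone_nat_of_succ_le fun j => ?_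
    induction j with
    | zero => exact (x 1).2.2
    | succ j ih =>
      rw [hx, hx j]
      exact powerMap_mono k hw (fun _ => le_rfl) ih
  obtain ⟨X, hX, φ, hφ, hlim⟩ := (PDCone.isCompact_bounds c C hc).tendsto_subseq
    (x := fun j => (x j).1) fun j => (x j).2
  have hlim1 : Filter.Tendsto (fun j => (x (φ j)).1.1) Filter.atTop (nhds X.1) :=
    (continuous_subtype_val.tendsto X).comp hlim
  have hlim2 : Filter.Tendsto (fun j => (x (φ j + 1)).1.1) Filter.atTop
      (nhds (powerMap k w A X)) := by
    simp only [hx]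
    exact ((continuous_powerMap k w A).tendsto X).comp hlim
  -- Monotonicity interlaces the subsequence with its shift: `x (φ (j+1)) ≤ x (φ j + 1) ≤ x (φ j)`.
  refine ⟨X, hX, le_antisymm ?_ ?_⟩
  · exact le_of_tendsto_of_tendsto' hlim2 hlim1 fun j => hanti (Nat.le_succ _)
  · exact le_of_tendsto_of_tendsto' (hlim1.comp (Filter.tendsto_add_atTop_nat 1)) hlim2
      fun j => hanti (hφ (Nat.lt_succ_self j))

end PowerMap

/-! ### The logarithm as a decreasing limit of difference quotients -/

section LogApprox

open scoped Matrix.Norms.L2Operator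

variable {m n : ℕ} {C : Matrix (Fin m) (Fin m) ℂ}

/-- The difference quotient `(C^t - 1) / t`, which decreases to `log C` as `t` decreases to `0`. -/
noncomputable def logApprox (t : ℝ) (C : Matrix (Fin m) (Fin m) ℂ) : Matrix (Fin m) (Fin m) ℂ :=
  t⁻¹ • (matPow C t - 1)

theorem logApprox_eq_cfc (hC : C.PosDef) (t : ℝ) :
    logApprox t C = cfc (fun x : ℝ => t⁻¹ * (x ^ t - 1)) C := by
  have hC' : IsSelfAdjoint C := hC.1
  rw [logApprox, matPow]
  simp only [← smul_eq_mul]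
  rw [cfc_smul _ _ _ (continuousOn_spectrum _ _), cfc_sub _ _ _ (continuousOn_spectrum _ _)
    (continuousOn_spectrum _ _), cfc_const_one ℝ C]

theorem matLog_le_logApprox (hC : C.PosDef) {t : ℝ} (ht : 0 < t) : matLog C ≤ logApprox t C := by
  rw [logApprox_eq_cfc hC]
  refine cfc_mono (fun x hx => ?_) (continuousOn_spectrum _ _) (continuousOn_spectrum _ _)
  have hx := hC.spectrum_pos hx
  have h := Real.log_le_sub_one_of_pos (Real.rpow_pos_of_pos hx t)
  rw [Real.log_rpow hx] at h
  rwa [le_inv_mul_iff₀ ht]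

/-- Bernoulli's inequality for the base `x^s` and exponent `t/s ≥ 1`. -/
theorem logApprox_mono (hC : C.PosDef) {s t : ℝ} (hs : 0 < s) (hst : s ≤ t) :
    logApprox s C ≤ logApprox t C := by
  rw [logApprox_eq_cfc hC, logApprox_eq_cfc hC]
  refine cfc_mono (fun x hx => ?_) (continuousOn_spectrum _ _) (continuousOn_spectrum _ _)
  have hx := hC.spectrum_pos hx
  have hxs := Real.rpow_pos_of_pos hx s
  have h := one_add_mul_self_le_rpow_one_add (s := x ^ s - 1) (by linarith)
    ((one_le_div hs).2 hst)
  rw [add_sub_cancel, ← Real.rpow_mul hx.le, mul_div_cancel₀ _ hs.ne'] at h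
  have ht := hs.trans_le hst
  rw [le_inv_mul_iff₀ ht, ← mul_assoc, ← div_eq_mul_inv]
  linarith

theorem tendsto_logApprox (hC : C.PosDef) :
    Filter.Tendsto (fun k : ℕ => logApprox ((1 / 2) ^ k) C) Filter.atTop (nhds (matLog C)) := by
  have h := CFC.tendsto_cfc_rpow_sub_one_log (ha := hC.isStrictlyPositive)
  have h2 : Filter.Tendsto (fun k : ℕ => (1 / 2 : ℝ) ^ k) Filter.atTop
      (nhdsWithin 0 (Set.Ioi 0)) :=
    tendsto_nhdsWithin_iff.2 ⟨tendsto_pow_atTop_nhds_zero_of_lt_one (by norm_num) (by norm_num),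
      Filter.Eventually.of_forall fun k => by simp only [Set.mem_Ioi]; positivity⟩
  exact (h.comp h2).congr fun k => (logApprox_eq_cfc hC _).symm

theorem PDCone.continuous_logApprox (t : ℝ) : Continuous fun C : PDCone m => logApprox t C.1 :=
  ((PDCone.continuous_matPow t).sub continuous_const).const_smul t⁻¹

/-- Exhibits the power mean equation as the Karcher equation with `log` replaced by its difference
quotient. -/
theorem relMat_powerMap (k : ℕ) {w : Fin n → ℝ} (hw1 : ∑ i, w i = 1) (A : Fin n → PDCone m)
    (X : PDCone m) :
    relMat X.1 (powerMap k w A X) =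
      1 + ((1 / 2 : ℝ) ^ k) • ∑ i, w i • logApprox ((1 / 2) ^ k) (relMat X.1 (A i).1) := by
  have ht : ((1 / 2 : ℝ) ^ k) ≠ 0 := by positivity
  have h : ∀ i, relMat X.1 (w i • geomMean ((1 / 2) ^ k) X.1 (A i).1) =
      w i • matPow (relMat X.1 (A i).1) ((1 / 2) ^ k) := fun i => by
    conv_rhs => rw [← relMat_conj X.2 (matPow (relMat X.1 (A i).1) ((1 / 2) ^ k))]
    simp only [relMat, geomMean, mul_smul_comm, smul_mul_assoc]
  have h' : relMat X.1 (powerMap k w A X) =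
      ∑ i, relMat X.1 (w i • geomMean ((1 / 2) ^ k) X.1 (A i).1) := by
    simp only [relMat, powerMap, Finset.mul_sum, Finset.sum_mul]
  simp only [h', h, logApprox, Finset.smul_sum, smul_smul]
  simp only [mul_left_comm _ (w _), mul_inv_cancel₀ ht, mul_one, smul_sub, Finset.sum_sub_distrib,
    ← Finset.sum_smul, hw1, one_smul, add_sub_cancel]

theorem le_powerMap_iff (k : ℕ) {w : Fin n → ℝ} (hw1 : ∑ i, w i = 1) (A : Fin n → PDCone m)
    (X : PDCone m) :
    X.1 ≤ powerMap k w A X ↔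
      0 ≤ ∑ i, w i • logApprox ((1 / 2) ^ k) (relMat X.1 (A i).1) := by
  have ht : 0 < ((1 / 2 : ℝ) ^ k) := by positivity
  constructor
  · intro h
    have := relMat_mono X.1 h
    rw [relMat_powerMap k hw1, relMat_self X.2, le_add_iff_nonneg_right] at this
    have h2 := smul_le_smul_of_nonneg_left this (inv_pos.2 ht).le
    rwa [smul_zero, smul_smul, inv_mul_cancel₀ ht.ne', one_smul] at h2
  · intro h
    have h1 : relMat X.1 X.1 ≤ relMat X.1 (powerMap k w A X) := by
      rw [relMat_powerMap k hw1, relMat_self X.2, le_add_iff_nonneg_right]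
      exact smul_nonneg ht.le h
    have h2 := (matPow_isHermitian X.1 (1 / 2)).conj_le_conj h1
    rwa [conj_relMat X.2, conj_relMat X.2] at h2

theorem sum_logApprox_eq_zero (k : ℕ) {w : Fin n → ℝ} (hw1 : ∑ i, w i = 1) {A : Fin n → PDCone m}
    {X : PDCone m} (h : powerMap k w A X = X.1) :
    ∑ i, w i • logApprox ((1 / 2) ^ k) (relMat X.1 (A i).1) = 0 := by
  have ht : ((1 / 2 : ℝ) ^ k) ≠ 0 := by positivity
  have h1 := relMat_powerMap k hw1 A X
  rw [h, relMat_self X.2, left_eq_add] at h1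
  exact (smul_eq_zero.1 h1).resolve_left ht

end LogApprox

/-! ### Existence of an extremal Karcher point -/

section Existence

open scoped Matrix.Norms.L2Operator

variable {m n : ℕ}

theorem le_powerMap_of_nonneg_sum_log (k : ℕ) {w : Fin n → ℝ} (hw : ∀ i, 0 ≤ w i)
    (hw1 : ∑ i, w i = 1) {A : Fin n → PDCone m} {X : PDCone m}
    (h : 0 ≤ ∑ i, w i • matLog (relMat X.1 (A i).1)) : X.1 ≤ powerMap k w A X :=
  (le_powerMap_iff k hw1 A X).2 <| h.trans <| sum_smul_le_sum_smul hw fun i =>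
    matLog_le_logApprox (relMat_posDef X.2 (A i).2) (by positivity)

theorem PDCone.continuous_sum_rel {w : Fin n → ℝ} (A : Fin n → PDCone m)
    {F : Matrix (Fin m) (Fin m) ℂ → Matrix (Fin m) (Fin m) ℂ}
    (hF : Continuous fun C : PDCone m => F C.1) :
    Continuous fun X : PDCone m => ∑ i, w i • F (relMat X.1 (A i).1) :=
  continuous_finsetSum _ fun i _ => (hF.comp (PDCone.continuous_rel.comp
    (continuous_id.prodMk (continuous_const (y := A i))))).const_smul (w i)

/-- The Karcher equation has a solution which is the greatest among the common subsolutions of the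
power mean equations. -/
theorem exists_isKarcherPoint {w : Fin n → ℝ} (hw : ∀ i, 0 ≤ w i) (hw1 : ∑ i, w i = 1)
    (A : Fin n → PDCone m) :
    ∃ X : PDCone m, IsKarcherPoint w A X ∧
      ∀ Z : PDCone m, (∀ k, Z.1 ≤ powerMap k w A Z) → Z.1 ≤ X.1 := by
  obtain ⟨c, C, hc, -, hcC, hA⟩ := PDCone.exists_bounds A
  choose x hx hfix using fun k => exists_powerMap_eq k hw hw1 hc hcC hA
  -- `X` is a cluster point of the power means as the exponent tends to `0`.
  obtain ⟨X, -, φ, hφ, hlim⟩ := (PDCone.isCompact_bounds c C hc).tendsto_subseq hx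
  refine ⟨X, le_antisymm ?_ ?_, fun Z hZ => ?_⟩
  · have h := ((PDCone.continuous_sum_rel (w := w) A PDCone.continuous_matLog).tendsto X).comp hlim
    refine le_of_tendsto' h fun j => ?_
    rw [← sum_logApprox_eq_zero _ hw1 (hfix (φ j))]
    exact sum_smul_le_sum_smul hw fun i =>
      matLog_le_logApprox (relMat_posDef (x (φ j)).2 (A i).2) (by positivity)
  · have h0 : ∀ k : ℕ, 0 ≤ ∑ i, w i • logApprox ((1 / 2) ^ k) (relMat X.1 (A i).1) := by
      intro k
      have h := ((PDCone.continuous_sum_rel (w := w) A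
        (PDCone.continuous_logApprox ((1 / 2) ^ k))).tendsto X).comp hlim
      refine ge_of_tendsto h ((Filter.eventually_ge_atTop k).mono fun j hj => ?_)
      rw [← sum_logApprox_eq_zero _ hw1 (hfix (φ j))]
      exact sum_smul_le_sum_smul hw fun i =>
        logApprox_mono (relMat_posDef (x (φ j)).2 (A i).2) (by positivity)
          (pow_le_pow_of_le_one (by norm_num) (by norm_num) (hj.trans (hφ.id_le j)))
    refine ge_of_tendsto' (tendsto_finsetSum _ fun i _ =>
      (tendsto_logApprox (relMat_posDef X.2 (A i).2)).const_smul (w i)) h0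
  · refine ge_of_tendsto' ((continuous_subtype_val.tendsto X).comp hlim) fun j => ?_
    exact le_of_le_powerMap_of_powerMap_le (φ j) hw (hZ _) (hfix (φ j)).le

end Existence

/-! ### The mean as greatest subsolution: order properties -/

section WeightedMean

variable {m n : ℕ}

theorem Weight.nonneg (w : Weight n) (i : Fin n) : 0 ≤ w.1 i := (w.2.1 i).1.le

theorem isKarcherPoint_weightedLeastSquaresMean (w : Weight n) (A : Fin n → PDCone m) :
    IsKarcherPoint w.1 A (weightedLeastSquaresMean w A) := by
  obtain ⟨X, hX, -⟩ := exists_isKarcherPoint w.nonneg w.2.2 A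
  rwa [← hX.eq_weightedLeastSquaresMean]

theorem isWeightedLeastSquaresPoint_iff (w : Weight n) (A : Fin n → PDCone m) (X : PDCone m) :
    IsWeightedLeastSquaresPoint w A X ↔ X = weightedLeastSquaresMean w A :=
  (isKarcherPoint_weightedLeastSquaresMean w A).isWeightedLeastSquaresPoint_iff X

theorem le_weightedLeastSquaresMean {w : Weight n} {A : Fin n → PDCone m} {Z : PDCone m}
    (h : ∀ k, Z.1 ≤ powerMap k w.1 A Z) : Z.1 ≤ (weightedLeastSquaresMean w A).1 := by
  obtain ⟨X, hX, hle⟩ := exists_isKarcherPoint w.nonneg w.2.2 A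
  rw [← hX.eq_weightedLeastSquaresMean]
  exact hle Z h

theorem weightedLeastSquaresMean_le_powerMap (k : ℕ) (w : Weight n) (A : Fin n → PDCone m) :
    (weightedLeastSquaresMean w A).1 ≤ powerMap k w.1 A (weightedLeastSquaresMean w A) :=
  le_powerMap_of_nonneg_sum_log k w.nonneg w.2.2 (isKarcherPoint_weightedLeastSquaresMean w A).ge

/-- The mean of `A` is a subsolution for the larger data `B`, hence lies below the mean of `B`. -/
theorem weightedLeastSquaresMean_mono (w : Weight n) {A B : Fin n → PDCone m}
    (h : ∀ i, (A i).1 ≤ (B i).1) :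
    (weightedLeastSquaresMean w A).1 ≤ (weightedLeastSquaresMean w B).1 :=
  le_weightedLeastSquaresMean fun k => (weightedLeastSquaresMean_le_powerMap k w A).trans
    (powerMap_mono k w.nonneg h le_rfl)

theorem weightedLeastSquaresMean_concave (w : Weight n) (t : Set.Icc (0 : ℝ) 1)
    (A B : Fin n → PDCone m) :
    t.1 • (weightedLeastSquaresMean w A).1 + (1 - t.1) • (weightedLeastSquaresMean w B).1 ≤
      (weightedLeastSquaresMean w fun i => PDCone.mix t (A i) (B i)).1 := by
  refine le_weightedLeastSquaresMean
    (Z := PDCone.mix t (weightedLeastSquaresMean w A) (weightedLeastSquaresMean w B)) fun k => ?_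
  have ht : 0 ≤ 1 - t.1 := sub_nonneg.2 t.2.2
  have h1 := add_le_add
    (smul_le_smul_of_nonneg_left (weightedLeastSquaresMean_le_powerMap k w A) t.2.1)
    (smul_le_smul_of_nonneg_left (weightedLeastSquaresMean_le_powerMap k w B) ht)
  refine h1.trans ?_
  simp only [powerMap, Finset.smul_sum, smul_comm t.1, smul_comm (1 - t.1),
    ← Finset.sum_add_distrib, ← smul_add]
  exact sum_smul_le_sum_smul w.nonneg fun i =>
    smul_geomMean_add_le k (weightedLeastSquaresMean w A).2 (weightedLeastSquaresMean w B).2 (A i).2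
      (B i).2 (PDCone.mix t _ _).2 (PDCone.mix t _ _).2 t.2.1 ht le_rfl le_rfl

theorem weightedLeastSquaresMean_le_arithmetic (w : Weight n) (A : Fin n → PDCone m) :
    (weightedLeastSquaresMean w A).1 ≤ ∑ i, w.1 i • (A i).1 := by
  -- At `k = 0` the exponent is `1` and the power map is the constant arithmetic mean.
  have h := weightedLeastSquaresMean_le_powerMap 0 w A
  simpa only [powerMap, pow_zero, geomMean_one (weightedLeastSquaresMean w A).2 (A _).2] using h

end WeightedMean

/-! ### Exponentials and commuting matrices -/

section Exponential

open scoped Matrix.Norms.L2Operator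

variable {m : ℕ} {A B : Matrix (Fin m) (Fin m) ℂ}

theorem posDef_exp (hA : A.IsHermitian) : (NormedSpace.exp A).PosDef := by
  have hA' : IsSelfAdjoint A := hA
  rw [← CFC.real_exp_eq_normedSpace_exp hA']
  exact posDef_cfc hA fun x _ => Real.exp_pos x

theorem matPow_eq_exp (hA : A.PosDef) (t : ℝ) : matPow A t = NormedSpace.exp (t • matLog A) := by
  rw [← matLog_matPow hA, exp_matLog (matPow_posDef hA t)]

theorem matPow_exp (hA : A.IsHermitian) (t : ℝ) :
    matPow (NormedSpace.exp A) t = NormedSpace.exp (t • A) := by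
  rw [matPow_eq_exp (posDef_exp hA), matLog_exp hA]

theorem commute_matLog (h : Commute A B) : Commute (matLog A) (matLog B) :=
  ((h.cfc_real Real.log).symm.cfc_real Real.log).symm

theorem relMat_exp_exp (hA : A.IsHermitian) (h : Commute A B) :
    relMat (NormedSpace.exp A) (NormedSpace.exp B) = NormedSpace.exp (B - A) := by
  rw [relMat, matPow_exp hA, ← Matrix.exp_add_of_commute _ _ (h.smul_left _),
    ← Matrix.exp_add_of_commute]
  · congr 1
    module
  · exact ((Commute.refl A).smul_left _ |>.add_left h.symm).smul_right _

theorem prod_ofFn_exp {n : ℕ} {f : Fin n → Matrix (Fin m) (Fin m) ℂ}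
    (h : ∀ i j, Commute (f i) (f j)) :
    (List.ofFn fun i => NormedSpace.exp (f i)).prod = NormedSpace.exp (∑ i, f i) := by
  induction n with
  | zero => simp
  | succ n ih =>
    rw [List.ofFn_succ, List.prod_cons, ih fun i j => h i.succ j.succ, Fin.sum_univ_succ,
      Matrix.exp_add_of_commute]
    exact Commute.sum_right _ _ _ fun i _ => h 0 i.succ

theorem inv_antitone (hA : A.PosDef) (h : A ≤ B) : B⁻¹ ≤ A⁻¹ := by
  rw [Matrix.nonsing_inv_eq_ringInverse, Matrix.nonsing_inv_eq_ringInverse]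
  exact CStarAlgebra.ringInverse_le_ringInverse h hA.isStrictlyPositive

end Exponential

/-! ### Determinants and traces of logarithms -/

section Determinant

variable {m : ℕ} {A X : Matrix (Fin m) (Fin m) ℂ}

theorem Matrix.PosDef.det_re_pos (hA : A.PosDef) : 0 < A.det.re :=
  (Complex.pos_iff.1 hA.det_pos).1

theorem Matrix.PosDef.det_eq_re (hA : A.PosDef) : A.det = (A.det.re : ℂ) :=
  Complex.ext rfl (Complex.pos_iff.1 hA.det_pos).2.symm

theorem trace_matLog (hA : A.PosDef) : (matLog A).trace.re = Real.log A.det.re := by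
  rw [matLog, trace_cfc_re hA.1, ← Real.log_prod fun i _ => (hA.eigenvalues_pos i).ne',
    hA.1.det_eq_prod_eigenvalues]
  congr 1
  norm_cast

theorem trace_matLog_relMat (hX : X.PosDef) (hA : A.PosDef) :
    (matLog (relMat X A)).trace.re = Real.log A.det.re - Real.log X.det.re := by
  have hR := relMat_posDef hX hA
  have h1 := congrArg Matrix.det (conj_relMat hX A)
  have h2 := congrArg Matrix.det (matPow_half_mul_half hX)
  rw [Matrix.det_mul] at h2
  rw [Matrix.det_mul, Matrix.det_mul, mul_right_comm, h2, hX.det_eq_re, hR.det_eq_re,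
    hA.det_eq_re] at h1
  have h3 : X.det.re * (relMat X A).det.re = A.det.re := by exact_mod_cast h1
  rw [trace_matLog hR, ← h3, Real.log_mul hX.det_re_pos.ne' hR.det_re_pos.ne', add_sub_cancel_left]

end Determinant

/-! ### Invariance, duality, determinant and commuting data -/

section WeightedAxioms

variable {m n : ℕ}

theorem PDCone.inv_inv (A : PDCone m) : A.inv.inv = A :=
  Subtype.ext (Matrix.nonsing_inv_nonsing_inv _ ((Matrix.isUnit_iff_isUnit_det _).1 A.2.isUnit))

theorem PDCone.congruence_congruence_inv (M : GL (Fin m) ℂ) (A : PDCone m) :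
    (A.congruence M⁻¹).congruence M = A := by
  refine Subtype.ext ?_
  have h : M.1 * (M⁻¹).1 = 1 := M.mul_inv
  have h' : (M⁻¹).1ᴴ * M.1ᴴ = 1 := by rw [← Matrix.conjTranspose_mul, h, Matrix.conjTranspose_one]
  simp only [PDCone.congruence]
  rw [show ∀ a b c d e : Matrix (Fin m) (Fin m) ℂ, a * (b * c * d) * e = (a * b) * c * (d * e) by
    intros; simp only [mul_assoc], h, h', one_mul, mul_one]

theorem weightedLeastSquaresMean_perm (w : Weight n) (σ : Equiv.Perm (Fin n))
    (A : Fin n → PDCone m) :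
    weightedLeastSquaresMean (w.perm σ) (fun i => A (σ i)) = weightedLeastSquaresMean w A := by
  refine (IsKarcherPoint.eq_weightedLeastSquaresMean ?_).symm
  have h := isKarcherPoint_weightedLeastSquaresMean w A
  rw [IsKarcherPoint, ← Equiv.sum_comp σ] at h
  exact h

theorem weightedLeastSquaresMean_congruence (w : Weight n) (M : GL (Fin m) ℂ)
    (A : Fin n → PDCone m) :
    weightedLeastSquaresMean w (fun i => (A i).congruence M) =
      (weightedLeastSquaresMean w A).congruence M := by
  refine ((isWeightedLeastSquaresPoint_iff w _ _).1 fun Y => ?_).symm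
  rw [← Y.congruence_congruence_inv M]
  simp only [riemDist_sq_congruence]
  exact (isWeightedLeastSquaresPoint_iff w A _).2 rfl _

/-- Inverting everything changes the sign of each logarithm in the Karcher equation. -/
theorem weightedLeastSquaresMean_inv (w : Weight n) (A : Fin n → PDCone m) :
    weightedLeastSquaresMean w (fun i => (A i).inv) = (weightedLeastSquaresMean w A).inv := by
  refine (IsKarcherPoint.eq_weightedLeastSquaresMean ?_).symm
  have h := isKarcherPoint_weightedLeastSquaresMean w A
  rw [IsKarcherPoint] at h ⊢
  have hX := (weightedLeastSquaresMean w A).2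
  simp only [PDCone.inv, relMat_inv hX, matLog_inv (relMat_posDef hX (A _).2), smul_neg,
    Finset.sum_neg_distrib, h, neg_zero]

theorem Weight.posDef_sum (w : Weight n) (A : Fin n → PDCone m) :
    (∑ i, w.1 i • (A i).1).PosDef :=
  (weightedLeastSquaresMean w A).2.of_le (weightedLeastSquaresMean_le_arithmetic w A)

theorem inv_weightedLeastSquaresMean_le (w : Weight n) (A : Fin n → PDCone m) :
    (weightedLeastSquaresMean w A).1⁻¹ ≤ ∑ i, w.1 i • (A i).1⁻¹ := by
  have h := weightedLeastSquaresMean_le_arithmetic w fun i => (A i).inv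
  rwa [weightedLeastSquaresMean_inv] at h

theorem harmonic_le_weightedLeastSquaresMean (w : Weight n) (A : Fin n → PDCone m) :
    (∑ i, w.1 i • (A i).1⁻¹)⁻¹ ≤ (weightedLeastSquaresMean w A).1 := by
  have h := inv_antitone (weightedLeastSquaresMean w A).inv.2 (inv_weightedLeastSquaresMean_le w A)
  exact h.trans_eq (congrArg Subtype.val (weightedLeastSquaresMean w A).inv_inv)

theorem Weight.prod_rpow_eq_exp (w : Weight n) {a : Fin n → ℝ} (ha : ∀ i, 0 < a i) :
    ∏ i, a i ^ w.1 i = Real.exp (∑ i, w.1 i * Real.log (a i)) := by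
  rw [Real.exp_sum]
  exact Finset.prod_congr rfl fun i _ => by rw [Real.rpow_def_of_pos (ha i), mul_comm]

/-- Rescaling shifts the `i`-th logarithm by the scalar `log aᵢ - ∑ wⱼ log aⱼ`, whose weighted sum
is zero. -/
theorem weightedLeastSquaresMean_scale (w : Weight n) (a : Fin n → {a : ℝ // 0 < a})
    (A : Fin n → PDCone m) :
    (weightedLeastSquaresMean w fun i => (A i).scale (a i)).1 =
      (∏ i, (a i).1 ^ w.1 i) • (weightedLeastSquaresMean w A).1 := by
  have h := isKarcherPoint_weightedLeastSquaresMean w A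
  set X := weightedLeastSquaresMean w A
  have hs : 0 < ∏ i, (a i).1 ^ w.1 i := Finset.prod_pos fun i _ => Real.rpow_pos_of_pos (a i).2 _
  have hk : IsKarcherPoint w.1 (fun i => (A i).scale (a i)) (X.scale ⟨_, hs⟩) := by
    rw [IsKarcherPoint] at h ⊢
    have hlog : ∀ i, matLog (relMat (X.scale ⟨_, hs⟩).1 ((A i).scale (a i)).1) =
        (Real.log (a i).1 - ∑ j, w.1 j * Real.log (a j).1) • 1 + matLog (relMat X.1 (A i).1) := by
      intro i
      simp only [PDCone.scale]
      rw [relMat_smul X.2 _ hs, matLog_smul (relMat_posDef X.2 (A i).2)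
        (mul_pos (inv_pos.2 hs) (a i).2), Real.log_mul (inv_pos.2 hs).ne' (a i).2.ne', Real.log_inv,
        w.prod_rpow_eq_exp fun i => (a i).2, Real.log_exp, neg_add_eq_sub]
    simp only [hlog, smul_add, Finset.sum_add_distrib, h, add_zero, smul_smul]
    rw [← Finset.sum_smul]
    simp only [mul_sub, Finset.sum_sub_distrib, ← Finset.sum_mul, w.2.2, one_mul, sub_self,
      zero_smul]
  exact (congrArg Subtype.val hk.eq_weightedLeastSquaresMean).symm

/-- The trace of the Karcher equation, with `tr log = log det`. -/
theorem det_weightedLeastSquaresMean (w : Weight n) (A : Fin n → PDCone m) :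
    (weightedLeastSquaresMean w A).1.det = ((∏ i, (A i).1.det.re ^ w.1 i : ℝ) : ℂ) := by
  have h := isKarcherPoint_weightedLeastSquaresMean w A
  set X := weightedLeastSquaresMean w A
  rw [IsKarcherPoint] at h
  have h1 := congrArg (fun B : Matrix (Fin m) (Fin m) ℂ => B.trace.re) h
  simp only [Matrix.trace_sum, Complex.re_sum, Matrix.trace_smul, Complex.real_smul,
    Complex.re_ofReal_mul, trace_matLog_relMat X.2 (A _).2, Matrix.trace_zero, Complex.zero_re,
    mul_sub, Finset.sum_sub_distrib, ← Finset.sum_mul, w.2.2, one_mul] at h1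
  rw [X.2.det_eq_re, w.prod_rpow_eq_exp fun i => (A i).2.det_re_pos, sub_eq_zero.1 h1,
    Real.exp_log X.2.det_re_pos]

theorem isHermitian_sum_smul_matLog (w : Fin n → ℝ) (A : Fin n → PDCone m) :
    (∑ i, w i • matLog (A i).1).IsHermitian :=
  isSelfAdjoint_sum _ fun i _ =>
    IsSelfAdjoint.smul (IsSelfAdjoint.all (w i)) (matLog_isHermitian (A i).1)

/-- For commuting data the relative logarithms are differences of logarithms, so the log-average
solves the Karcher equation. -/
theorem weightedLeastSquaresMean_of_commute (w : Weight n) (A : Fin n → PDCone m)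
    (h : ∀ i j, Commute (A i).1 (A j).1) :
    (weightedLeastSquaresMean w A).1 = NormedSpace.exp (∑ i, w.1 i • matLog (A i).1) := by
  have hL := isHermitian_sum_smul_matLog w.1 A
  have hk : IsKarcherPoint w.1 A ⟨_, posDef_exp hL⟩ := by
    have hlog : ∀ i, matLog (relMat (NormedSpace.exp (∑ i, w.1 i • matLog (A i).1)) (A i).1) =
        matLog (A i).1 - ∑ i, w.1 i • matLog (A i).1 := by
      intro i
      conv_lhs => rw [← exp_matLog (A i).2]
      rw [relMat_exp_exp hL, matLog_exp ((matLog_isHermitian _).sub hL)]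
      exact Commute.sum_left _ _ _ fun j _ => (commute_matLog (h j i)).smul_left _
    rw [IsKarcherPoint]
    simp only [hlog, smul_sub, Finset.sum_sub_distrib, ← Finset.sum_smul, w.2.2, one_smul, sub_self]
  exact (congrArg Subtype.val hk.eq_weightedLeastSquaresMean).symm

theorem prod_ofFn_matPow (w : Fin n → ℝ) (A : Fin n → PDCone m)
    (h : ∀ i j, Commute (A i).1 (A j).1) :
    (List.ofFn fun i => matPow (A i).1 (w i)).prod =
      NormedSpace.exp (∑ i, w i • matLog (A i).1) := by
  simp only [matPow_eq_exp (A _).2]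
  exact prod_ofFn_exp fun i j => ((commute_matLog (h i j)).smul_left _).smul_right _

end WeightedAxioms

/-! ### Joint continuity -/

section Continuity

open scoped Matrix.Norms.L2Operator

variable {m n : ℕ}

theorem continuous_sum_log_rel :
    Continuous fun q : (Weight n × (Fin n → PDCone m)) × PDCone m =>
      ∑ i, q.1.1.1 i • matLog (relMat q.2.1 (q.1.2 i).1) := by
  refine continuous_finsetSum _ fun i _ => ?_
  have h1 : Continuous fun q : (Weight n × (Fin n → PDCone m)) × PDCone m => q.1.1.1 i :=
    (continuous_apply i).comp (continuous_subtype_val.comp (continuous_fst.comp continuous_fst))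
  have h2 : Continuous fun q : (Weight n × (Fin n → PDCone m)) × PDCone m =>
      matLog (relMat q.2.1 (q.1.2 i).1) :=
    PDCone.continuous_matLog.comp (PDCone.continuous_rel.comp (continuous_snd.prodMk
      ((continuous_apply i).comp (continuous_snd.comp continuous_fst))))
  exact h1.smul h2

theorem continuous_norm_weighted_sum {F : Matrix (Fin m) (Fin m) ℂ → Matrix (Fin m) (Fin m) ℂ}
    (hF : Continuous fun C : PDCone m => F C.1) :
    Continuous fun p : Weight n × (Fin n → PDCone m) => ‖∑ i, p.1.1 i • F (p.2 i).1‖ := by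
  refine (continuous_finsetSum _ fun i _ => ?_).norm
  have h1 : Continuous fun p : Weight n × (Fin n → PDCone m) => p.1.1 i :=
    (continuous_apply i).comp (continuous_subtype_val.comp continuous_fst)
  have h2 : Continuous fun p : Weight n × (Fin n → PDCone m) => F (p.2 i).1 :=
    hF.comp ((continuous_apply i).comp continuous_snd)
  exact h1.smul h2

theorem Matrix.IsHermitian.le_smul_one {A : Matrix (Fin m) (Fin m) ℂ} (hA : A.IsHermitian) {r : ℝ}
    (h : ‖A‖ ≤ r) : A ≤ r • 1 := by
  have h' := IsSelfAdjoint.le_algebraMap_norm_self (a := A) hA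
  rw [Algebra.algebraMap_eq_smul_one] at h'
  exact h'.trans (real_smul_one_le_smul_one h)

/-- The arithmetic and harmonic bounds confine nearby means to one compact interval. Every cluster
point solves the Karcher equation at the limit data, and that solution is unique. -/
theorem continuous_weightedLeastSquaresMean :
    Continuous fun p : Weight n × (Fin n → PDCone m) => weightedLeastSquaresMean p.1 p.2 := by
  refine continuous_iff_continuousAt.2 fun p => ?_
  have h1 := continuous_norm_weighted_sum (m := m) (n := n) (F := id) continuous_subtype_val
  have h2 : Continuous fun p : Weight n × (Fin n → PDCone m) => ‖∑ i, p.1.1 i • (p.2 i).1⁻¹‖ := by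
    refine continuous_norm_weighted_sum (F := fun C => C⁻¹) ?_
    exact (PDCone.continuous_matPow (-1)).congr fun C => matPow_neg_one C.2
  -- The `+ 1` makes the norm bounds strict at `p`, hence valid nearby, and keeps `b` positive.
  set a := ‖∑ i, p.1.1 i • (p.2 i).1‖ + 1
  set b := ‖∑ i, p.1.1 i • (p.2 i).1⁻¹‖ + 1 with hb
  have hb0 : 0 < b := by positivity
  have hev : ∀ᶠ q in nhds p, b⁻¹ • (1 : Matrix (Fin m) (Fin m) ℂ) ≤
      (weightedLeastSquaresMean q.1 q.2).1 ∧ (weightedLeastSquaresMean q.1 q.2).1 ≤ a • 1 := by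
    filter_upwards [h1.continuousAt.eventually_lt_const (lt_add_one _),
      h2.continuousAt.eventually_lt_const (lt_add_one _)] with q hq1 hq2
    have hX := (weightedLeastSquaresMean q.1 q.2).2
    have hle := inv_weightedLeastSquaresMean_le q.1 q.2
    constructor
    · have h3 := inv_antitone hX.inv
        (hle.trans ((hX.inv.of_le hle).1.le_smul_one hq2.le))
      rw [Matrix.nonsing_inv_nonsing_inv _ ((Matrix.isUnit_iff_isUnit_det _).1 hX.isUnit)] at h3
      refine le_of_eq_of_le (Matrix.inv_eq_left_inv ?_).symm h3
      rw [smul_mul_smul_comm, inv_mul_cancel₀ hb0.ne', one_smul, one_mul]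
    · exact (weightedLeastSquaresMean_le_arithmetic q.1 q.2).trans
        ((q.1.posDef_sum q.2).1.le_smul_one hq1.le)
  refine (PDCone.isCompact_bounds b⁻¹ a (inv_pos.2 hb0)).tendsto_nhds_of_unique_mapClusterPt hev
    fun X _ hX => ?_
  obtain ⟨U, hU, hlim⟩ := mapClusterPt_iff_ultrafilter.1 hX
  refine IsKarcherPoint.eq_weightedLeastSquaresMean ?_
  have ht := (continuous_sum_log_rel.tendsto (p, X)).comp
    ((Filter.tendsto_id'.2 hU).prodMk_nhds hlim)
  refine tendsto_nhds_unique ht (tendsto_const_nhds.congr fun q => ?_)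
  exact (isKarcherPoint_weightedLeastSquaresMean q.1 q.2).symm

end Continuity

/-! ### Uniform weights and the unweighted axioms -/

section Unweighted

variable {m n : ℕ}

/-- The weight `(1/n, …, 1/n)`. -/
noncomputable def Weight.uniform (hn : 0 < n) : Weight n :=
  ⟨fun _ => 1 / n, fun _ => ⟨by positivity, by
    rw [div_le_one (by positivity)]; exact_mod_cast hn⟩, by
    simp [Nat.pos_iff_ne_zero.1 hn]⟩

theorem isLeastSquaresPoint_iff_uniform (hn : 0 < n) (A : Fin n → PDCone m) (X : PDCone m) :
    IsLeastSquaresPoint A X ↔ IsWeightedLeastSquaresPoint (Weight.uniform hn) A X := by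
  have h : (0 : ℝ) < 1 / n := by positivity
  simp only [IsLeastSquaresPoint, IsWeightedLeastSquaresPoint, Weight.uniform, ← Finset.mul_sum,
    mul_le_mul_iff_right₀ h]

/-- The minimality predicates coincide, so `Classical.epsilon` makes the same choice. -/
theorem leastSquaresMean_eq (hn : 0 < n) :
    leastSquaresMean (n := n) (m := m) = weightedLeastSquaresMean (Weight.uniform hn) := by
  funext A
  rw [leastSquaresMean, weightedLeastSquaresMean]
  congr 1
  funext X
  exact propext (isLeastSquaresPoint_iff_uniform hn A X)

theorem weightedALMAxioms :
    WeightedALMAxiomsExceptMonotone (weightedLeastSquaresMean (n := n) (m := m)) where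
  consistency_with_scalars w A h := by
    rw [weightedLeastSquaresMean_of_commute w A h, prod_ofFn_matPow w.1 A h]
  joint_homogeneity := weightedLeastSquaresMean_scale
  permutation_invariance := weightedLeastSquaresMean_perm
  continuity := continuous_weightedLeastSquaresMean
  congruence_invariance := weightedLeastSquaresMean_congruence
  joint_concavity := weightedLeastSquaresMean_concave
  self_duality w A := by rw [weightedLeastSquaresMean_inv, PDCone.inv_inv]
  determinantal_identity := det_weightedLeastSquaresMean
  harmonic_le := harmonic_le_weightedLeastSquaresMean
  le_arithmetic := weightedLeastSquaresMean_le_arithmetic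

theorem almAxioms (hn : 0 < n) :
    ALMAxiomsExceptMonotone (leastSquaresMean (n := n) (m := m)) := by
  rw [leastSquaresMean_eq hn]
  have W := weightedALMAxioms (n := n) (m := m)
  have hn' : (n : ℝ) ≠ 0 := by positivity
  refine ⟨fun A h => ?_, fun a A => ?_, fun σ A => ?_, ?_, W.congruence_invariance _,
    W.joint_concavity _, W.self_duality _, W.determinantal_identity _, fun A => ?_, fun A => ?_⟩
  -- Exponents all equal to `1` write the product itself as the exponential of the sum of
  -- logarithms, whose `1/n`-th power is then immediate.
  · have h1 := prod_ofFn_matPow (fun _ => 1) A h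
    simp only [matPow_one (A _).2, one_smul] at h1
    have hH := isHermitian_sum_smul_matLog (fun _ => 1) A
    simp only [one_smul] at hH
    rw [weightedLeastSquaresMean_of_commute _ A h, h1, matPow_exp hH, Finset.smul_sum]
    rfl
  · rw [W.joint_homogeneity, ← Real.finsetProd_rpow _ _ fun i _ => (a i).2.le]
    rfl
  · exact W.permutation_invariance (Weight.uniform hn) σ A
  · exact W.continuity.comp (continuous_const.prodMk continuous_id)
  · have h := W.harmonic_le (Weight.uniform hn) A
    have hS := ((Weight.uniform hn).posDef_sum fun i => (A i).inv)
    simp only [Weight.uniform, PDCone.inv, ← Finset.smul_sum] at h hS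
    refine le_of_eq_of_le (Matrix.inv_eq_left_inv ?_).symm h
    have hS' : (∑ i, (A i).1⁻¹).PosDef := by
      have := hS.smul (show (0 : ℝ) < n by positivity)
      rwa [smul_smul, mul_one_div_cancel hn', one_smul] at this
    rw [smul_mul_smul_comm, mul_one_div_cancel hn', one_smul, hS'.inv_mul_self]
  · have h := W.le_arithmetic (Weight.uniform hn) A
    simpa only [Weight.uniform, ← Finset.smul_sum] using h

end Unweighted

theorem theorem6p1 (n m : ℕ) (hn : 3 ≤ n) :
    -- the two means are well defined: the minimizers exist and are unique
    ((∀ (A : Fin n → PDCone m) (X : PDCone m),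
        IsLeastSquaresPoint A X ↔ X = leastSquaresMean A) ∧
      (∀ (w : Weight n) (A : Fin n → PDCone m) (X : PDCone m),
        IsWeightedLeastSquaresPoint w A X ↔ X = weightedLeastSquaresMean w A)) ∧
    -- monotonicity for the Loewner order
    ((∀ A B : Fin n → PDCone m, (∀ i, (A i).1 ≤ (B i).1) →
        (leastSquaresMean A).1 ≤ (leastSquaresMean B).1) ∧
      (∀ (w : Weight n) (A B : Fin n → PDCone m), (∀ i, (A i).1 ≤ (B i).1) →
        (weightedLeastSquaresMean w A).1 ≤ (weightedLeastSquaresMean w B).1)) ∧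
    -- the other nine axioms, unweighted and weighted
    (ALMAxiomsExceptMonotone (leastSquaresMean (n := n) (m := m)) ∧
      WeightedALMAxiomsExceptMonotone (weightedLeastSquaresMean (n := n) (m := m))) := by
  have hn0 : 0 < n := by omega
  refine ⟨⟨fun A X => ?_, isWeightedLeastSquaresPoint_iff⟩,
    ⟨fun A B h => ?_, fun w A B h => weightedLeastSquaresMean_mono w h⟩,
    almAxioms hn0, weightedALMAxioms⟩
  · rw [leastSquaresMean_eq hn0, isLeastSquaresPoint_iff_uniform hn0,
      isWeightedLeastSquaresPoint_iff]
  · rw [leastSquaresMean_eq hn0]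
    exact weightedLeastSquaresMean_mono _ h
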